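/- A precubical set is a graded set $P=(P_n)_{n\ge 0}$ with face operators $d^k_i\colon P_n\to P_{n-1}$ ($n>0$, $k\in\{0,1\}$, $1\le i\le n$) satisfying $d^k_i d^l_j=d^l_{j-1}d^k_i$ for $i<j$. Let $[\![0,1]\!]^{\otimes n}$ be the precubical $n$-cube, i.e. the $n$-fold tensor power of the precubical interval $[\![0,1]\!]$; its elements are the sequences with entries in $\{0,1,[0,1]\}$, graded by the number of entries equal to $[0,1]$. For $x\in P_n$, let $x_\sharp\colon[\![0,1]\!]^{\otimes n}\to P$ be the unique morphism of precubical sets sending the top cube $([0,1],\dots,[0,1])$ to $x$. The element $x$ is regular if $x_\sharp$ is injective, and weakly regular if the restriction of $x_\sharp$ to the sequences without entry $1$ and its restriction to the sequences without entry $0$ are both injective; $P$ is weakly regular if all its elements are. The star of $x$ is the set of all $y\in P$ such that $x$ lies in the image of $y_\sharp$, and a face $d^k_ix$ of $x$ is free if $\mathrm{star}(d^k_ix)=\{x,d^k_ix\}$. For $x \in P_n$, $n\ge 1$, let $e^k_ix=d^{1-k}_1\cdots d^{1-k}_{i-1}d^{1-k}_{i+1}\cdots d^{1-k}_nx\in P_1$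 (so $e^k_1x=x$ if $n=1$). For vertices $v,w\in P_0$, write $v\to_P w$ if there is a path in $P$ from $v$ to $w$, i.e. a morphism $\omega\colon[\![0,r]\!]\to P$ from a precubical interval, for some $r\ge 0$, with $\omega(0)=v$ and $\omega(r)=w$. Let $|P|$ denote the geometric realization of $P$, and let $H_*$ be singular homology with coefficients in a fixed arbitrary commutative unital ring. For homology classes $\alpha,\beta\in H_*(|P|)$, of possibly different degrees, write $\alpha\nearrow\beta$ if there exist precubical subsets $X,Y\subseteq P$ such that $\alpha\in\mathrm{im}\,H_*(|X|\hookrightarrow|P|)$, $\beta\in\mathrm{im}\,H_*(|Y|\hookrightarrow|P|)$, and $x\to_P y$ for all vertices $x\in X_0$ and $y\in Y_0$. The homology graph of $P$ is the directed graph whose vertices are the homology classes of $|P|$ and whose edges are given by the relation $\nearrow$. Theorem. Let $P$ be a weakly regular precubical set, let $x\in P_n$ be a regular element of degree $n\ge1$, and let $k\in\{0,1\}$ and $1\le i\le n$ be such that the face $d^k_ix$ is free. Suppose that there exists no edge $y\in P_1\setminus\{e^k_ix\}$ such that $d^k_1y=d^{1-k}_1\cdots d^{1-k}_1d^k_ix$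 (with $n-1$ operators $d^{1-k}_1$). Let $Q$ be the precubical subset $P\setminus\mathrm{star}(d^k_ix)$ of $P$, and let $\iota\colon|Q|\hookrightarrow|P|$ be the inclusion. Then $\iota_*\colon H_*(|Q|)\to H_*(|P|)$ is an isomorphism of homology graphs: it is bijective on homology classes, and for all homology classes $\alpha,\beta\in H_*(|Q|)$, $\alpha\nearrow\beta$ in the homology graph of $Q$ if and only if $\iota_*(\alpha)\nearrow\iota_*(\beta)$ in the homology graph of $P$. -/

import Mathlib

universe u v w

/-- A precubical set: a graded set `(P_n)` with face operators `d^k_i : P_{n+1} → P_n`, subject to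
`d^k_i ∘ d^l_j = d^l_{j-1} ∘ d^k_i` for `i < j`. The superscript `k ∈ {0,1}` is a Boolean
(`0 = false`, `1 = true`, `1 - k = !k`), and the lower index of a face operator is counted from `0`
(`Fin (n + 1)`) instead of from `1`. -/
structure PrecubicalSet where
  /-- the `n`-cubes -/
  cube : ℕ → Type u
  /-- the face operators -/
  d : Bool → ∀ {n : ℕ}, Fin (n + 1) → cube (n + 1) → cube n
  d_d : ∀ (k l : Bool) {n : ℕ} (i j : Fin (n + 1)), i ≤ j → ∀ x : cube (n + 2),
    d k i (d l j.succ x) = d l j (d k i.castSucc x)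

namespace PrecubicalSet

/-- Morphisms of precubical sets. -/
@[ext]
structure Hom (P : PrecubicalSet.{u}) (Q : PrecubicalSet.{v}) where
  /-- the map on cubes of each degree -/
  app : ∀ {n : ℕ}, P.cube n → Q.cube n
  app_d : ∀ (k : Bool) {n : ℕ} (i : Fin (n + 1)) (x : P.cube (n + 1)),
    app (P.d k i x) = Q.d k i (app x)

/-- Composition of morphisms. -/
def Hom.comp {P : PrecubicalSet.{u}} {Q : PrecubicalSet.{v}} {S : PrecubicalSet.{w}}
    (g : Hom Q S) (f : Hom P Q) : Hom P S where
  app x := g.app (f.app x)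
  app_d k _ i x := by rw [f.app_d, g.app_d]

/-- A morphism is injective if it is injective in each degree. -/
def Hom.Injective {P : PrecubicalSet.{u}} {Q : PrecubicalSet.{v}} (f : Hom P Q) : Prop :=
  ∀ m : ℕ, Function.Injective (f.app (n := m))

/-! ### The precubical `n`-cube -/

/-- The `m`-cubes of the `n`-fold tensor power of the precubical interval `⟦0,1⟧`: the sequences
`(a_1, …, a_n)` in which `m` entries are the edge `[0,1]` and the other entries are vertices
`0` or `1`. -/
inductive Cell : ℕ → ℕ → Type
  | nil : Cell 0 0
  | vertex (k : Bool) {n m : ℕ} (a : Cell n m) : Cell (n + 1) m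
  | edge {n m : ℕ} (a : Cell n m) : Cell (n + 1) (m + 1)

namespace Cell

/-- `d^k_i` replaces the `i`-th entry `[0,1]` by the vertex `k`. -/
def d (k : Bool) : ∀ {n m : ℕ}, Fin (m + 1) → Cell n (m + 1) → Cell n m
  | _, _, i, vertex l a => vertex l (d k i a)
  | _, 0, _, edge a => vertex k a
  | _, _ + 1, i, edge a => Fin.cases (vertex k a) (fun j => edge (d k j a)) i

@[simp] theorem d_vertex (k l : Bool) {n m : ℕ} (i : Fin (m + 1)) (a : Cell n (m + 1)) :
    d k i (vertex l a) = vertex l (d k i a) := by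
  cases m <;> rfl

@[simp] theorem d_zero_edge (k : Bool) {n m : ℕ} (a : Cell n m) :
    d k 0 (edge a) = vertex k a := by
  cases m <;> rfl

@[simp] theorem d_succ_edge (k : Bool) {n m : ℕ} (i : Fin (m + 1)) (a : Cell n (m + 1)) :
    d k i.succ (edge a) = edge (d k i a) := rfl

theorem d_d (k l : Bool) {n : ℕ} : ∀ {m : ℕ} (i j : Fin (m + 1)), i ≤ j →
    ∀ a : Cell n (m + 2), d k i (d l j.succ a) = d l j (d k i.castSucc a) := by
  induction n with
  | zero => intro m i j _ a; cases a
  | succ n ih =>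
    intro m i j hij a
    cases a with
    | vertex p a => simp [ih i j hij a]
    | edge a =>
      induction i using Fin.cases with
      | zero => simp
      | succ i =>
        induction j using Fin.cases with
        | zero => simp at hij
        | succ j =>
          cases m with
          | zero => exact i.elim0
          | succ m =>
            rw [d_succ_edge, d_succ_edge, Fin.castSucc_succ, d_succ_edge, d_succ_edge,
              ih i j (by simpa using hij) a]

/-- The top-dimensional cube `ι_n = ([0,1], …, [0,1])`. -/
def top : ∀ n : ℕ, Cell n n
  | 0 => nil
  | n + 1 => edge (top n)

/-- No entry of the sequence is the vertex `l`. For `l = 1` these are the elements of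
`⟦0,1⟦^{⊗ n}`, for `l = 0` those of `⟧0,1⟧^{⊗ n}`. -/
def Avoids (l : Bool) : ∀ {n m : ℕ}, Cell n m → Prop
  | _, _, nil => True
  | _, _, vertex k a => k ≠ l ∧ Avoids l a
  | _, _, edge a => Avoids l a

end Cell

/-- The precubical `n`-cube `⟦0,1⟧^{⊗ n}`. -/
abbrev stdCube (n : ℕ) : PrecubicalSet.{0} where
  cube m := Cell n m
  d k _ i a := Cell.d k i a
  d_d k l _ i j hij a := Cell.d_d k l i j hij a

/-! ### The morphism `x_♯` -/

/-- The shifted precubical set, which forgets the face operators with the lowest index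
(auxiliary). -/
abbrev shift (P : PrecubicalSet.{u}) : PrecubicalSet.{u} where
  cube n := P.cube (n + 1)
  d k _ i x := P.d k i.succ x
  d_d k l _ i j hij x := P.d_d k l i.succ j.succ (by simpa using hij) x

/-- The image of a cell under `x_♯`: a first entry `k` means passing to the first face `d^k_1 x`,
a first entry `[0,1]` means that the operators with lowest index are not used. -/
def sharpFun : ∀ {n m : ℕ}, Cell n m → ∀ P : PrecubicalSet.{u}, P.cube n → P.cube m
  | _, _, .nil, _, x => x
  | _, _, .vertex k a, P, x => sharpFun a P (P.d k 0 x)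
  | _, _, .edge a, P, x => sharpFun a P.shift x

theorem app_sharpFun {n m : ℕ} (a : Cell n m) : ∀ {P : PrecubicalSet.{u}} {Q : PrecubicalSet.{v}}
    (f : Hom P Q) (x : P.cube n), f.app (sharpFun a P x) = sharpFun a Q (f.app x) := by
  induction a with
  | nil => intro P Q f x; rfl
  | vertex k a ih => intro P Q f x; simp only [sharpFun]; rw [ih, f.app_d]
  | edge a ih =>
    intro P Q f x
    exact ih (P := P.shift) (Q := Q.shift) ⟨f.app, fun k _ i y => f.app_d k i.succ y⟩ x

theorem sharpFun_d (k : Bool) {n : ℕ} : ∀ {m : ℕ} (i : Fin (m + 1)) (a : Cell n (m + 1))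
    (P : PrecubicalSet.{u}) (x : P.cube n),
    sharpFun (Cell.d k i a) P x = P.d k i (sharpFun a P x) := by
  induction n with
  | zero => intro m i a; cases a
  | succ n ih =>
    intro m i a P x
    cases a with
    | vertex l a => rw [Cell.d_vertex]; exact ih i a P _
    | edge a =>
      induction i using Fin.cases with
      | zero =>
        rw [Cell.d_zero_edge]
        exact (app_sharpFun a (P := P.shift) (Q := P)
          ⟨fun y => P.d k 0 y, fun l _ i y => P.d_d k l 0 i (Fin.zero_le i) y⟩ x).symm
      | succ i =>
        cases m with
        | zero => exact i.elim0
        | succ m => rw [Cell.d_succ_edge]; exact ih i a P.shift x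

/-- The morphism `x_♯ : ⟦0,1⟧^{⊗ n} → P` with `ι_n ↦ x`. -/
def sharp (P : PrecubicalSet.{u}) {n : ℕ} (x : P.cube n) : Hom (stdCube n) P where
  app a := sharpFun a P x
  app_d k _ i a := sharpFun_d k i a P x

theorem sharp_top {n : ℕ} : ∀ (P : PrecubicalSet.{u}) (x : P.cube n),
    (P.sharp x).app (Cell.top n) = x := by
  induction n with
  | zero => intro P x; rfl
  | succ n ih => intro P x; exact ih P.shift x

/-- `x_♯` is the only morphism with `ι_n ↦ x`. -/
theorem app_eq_sharp {n m : ℕ} (a : Cell n m) : ∀ {P : PrecubicalSet.{u}} (f : Hom (stdCube n) P),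
    f.app a = (P.sharp (f.app (Cell.top n))).app a := by
  induction a with
  | nil => intro P f; rfl
  | @vertex k n m a ih =>
    intro P f
    have h := ih (P := P) ⟨fun b => f.app (n := _) (Cell.vertex k b),
      fun l _ i b => (congrArg (fun c => f.app c) (Cell.d_vertex l k i b).symm).trans (f.app_d l i (Cell.vertex k b))⟩
    have h0 : f.app (n := n) (Cell.vertex k (Cell.top n)) = P.d k 0 (f.app (Cell.top (n + 1))) :=
      (congrArg f.app (Cell.d_zero_edge k (Cell.top n)).symm).trans (f.app_d k 0 _)
    exact h.trans (congrArg (sharpFun a P) h0)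
  | @edge n m a ih =>
    intro P f
    exact ih (P := P.shift) ⟨fun {m} b => f.app (n := m + 1) (Cell.edge b),
      fun l m i b => f.app_d l i.succ (Cell.edge b)⟩

/-- A cube `x` is regular if `x_♯` is injective. -/
def Regular (P : PrecubicalSet.{u}) {n : ℕ} (x : P.cube n) : Prop :=
  (P.sharp x).Injective

/-- A cube `x` is weakly regular if the restrictions of `x_♯` to `⟦0,1⟦^{⊗ n}` and to
`⟧0,1⟧^{⊗ n}` are injective. -/
def WeaklyRegularAt (P : PrecubicalSet.{u}) {n : ℕ} (x : P.cube n) : Prop :=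
  ∀ (l : Bool) (m : ℕ) (a b : Cell n m), a.Avoids l → b.Avoids l →
    (P.sharp x).app a = (P.sharp x).app b → a = b

/-- A precubical set is weakly regular if all its elements are weakly regular. -/
def WeaklyRegular (P : PrecubicalSet.{u}) : Prop :=
  ∀ (n : ℕ) (x : P.cube n), P.WeaklyRegularAt x

/-! ### Stars and free faces -/

/-- `star(x) = {y : x ∈ y_♯(⟦0,1⟧^{⊗ deg y})}`. -/
def star (P : PrecubicalSet.{u}) {m : ℕ} (x : P.cube m) : Set (Σ n, P.cube n) :=
  {y | ∃ a : Cell y.1 m, (P.sharp y.2).app a = x}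

/-- The face `d^k_i x` of `x` is free if `star(d^k_i x) = {x, d^k_i x}`. -/
def IsFreeFace (P : PrecubicalSet.{u}) {n : ℕ} (k : Bool) (i : Fin (n + 1)) (x : P.cube (n + 1)) :
    Prop :=
  P.star (P.d k i x) = {⟨n + 1, x⟩, ⟨n, P.d k i x⟩}

/-- The vertex `d^l_1 ⋯ d^l_1 x`. -/
def corner (P : PrecubicalSet.{u}) (l : Bool) : ∀ {n : ℕ}, P.cube n → P.cube 0
  | 0, x => x
  | _ + 1, x => corner P l (P.d l 0 x)

/-- The edge `e^k_i x = d^{1-k}_1 ⋯ d^{1-k}_{i-1} d^{1-k}_{i+1} ⋯ d^{1-k}_n x` of a cube `x` of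
degree `n ≥ 1` (`e^k_1 x = x` for `n = 1`). As long as `i` is not the last index, the face operator
with the last index is applied; if `i` is the last index, the one with the last index but one. -/
def edge (P : PrecubicalSet.{u}) (k : Bool) : ∀ {n : ℕ}, Fin (n + 1) → P.cube (n + 1) → P.cube 1
  | 0, _, x => x
  | n + 1, i, x =>
    if h : i = Fin.last (n + 1) then edge P k (Fin.last n) (P.d (!k) (Fin.last n).castSucc x)
    else edge P k (i.castPred h) (P.d (!k) (Fin.last (n + 1)) x)

/-! ### Paths -/

/-- The cubes of the precubical interval `⟦0,r⟧`: vertices `0, …, r` and edges `[j, j+1]`, the latter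
indexed by `j < r`. -/
def IntervalCube (r : ℕ) : ℕ → Type
  | 0 => Fin (r + 1)
  | 1 => Fin r
  | _ + 2 => Empty

/-- The precubical interval `⟦0,r⟧`: the edge `[j, j+1]` leads from `j` to `j+1`. -/
def interval (r : ℕ) : PrecubicalSet.{0} where
  cube := IntervalCube r
  d k n _ := match n with
    | 0 => fun j : Fin r => (if k then j.succ else j.castSucc : Fin (r + 1))
    | _ + 1 => fun y : Empty => y.elim
  d_d _ _ _ _ _ _ x := Empty.elim x

/-- The vertex `j` of `⟦0,r⟧`. -/
def interval.vertex {r : ℕ} (j : Fin (r + 1)) : (interval r).cube 0 := j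

/-- `v →_P w`: there exists a path in `P`, i.e. a morphism `⟦0,r⟧ → P`, from `v` to `w`. -/
def Accessible (P : PrecubicalSet.{u}) (v w : P.cube 0) : Prop :=
  ∃ (r : ℕ) (ω : Hom (interval r) P),
    ω.app (interval.vertex 0) = v ∧ ω.app (interval.vertex (Fin.last r)) = w

/-! ### Precubical subsets -/

/-- A precubical subset: a graded subset that is stable under the face operators. -/
structure Sub (P : PrecubicalSet.{u}) where
  /-- the `n`-cubes of the precubical subset -/
  carrier : ∀ n : ℕ, Set (P.cube n)
  d_mem : ∀ (k : Bool) {n : ℕ} (i : Fin (n + 1)) (x : P.cube (n + 1)),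
    x ∈ carrier (n + 1) → P.d k i x ∈ carrier n

/-- A precubical subset as a precubical set. -/
abbrev Sub.toPrecubicalSet {P : PrecubicalSet.{u}} (X : P.Sub) : PrecubicalSet.{u} where
  cube n := {x : P.cube n // x ∈ X.carrier n}
  d k _ i x := ⟨P.d k i x.1, X.d_mem k i x.1 x.2⟩
  d_d k l _ i j hij x := Subtype.ext (P.d_d k l i j hij x.1)

/-- The inclusion of a precubical subset. -/
def Sub.incl {P : PrecubicalSet.{u}} (X : P.Sub) : Hom X.toPrecubicalSet P where
  app x := x.1
  app_d _ _ _ _ := rfl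

theorem mem_star_of_d_mem_star (P : PrecubicalSet.{u}) {m : ℕ} (z : P.cube m) (k : Bool) {n : ℕ}
    (i : Fin (n + 1)) (x : P.cube (n + 1)) (h : (⟨n, P.d k i x⟩ : Σ n, P.cube n) ∈ P.star z) :
    (⟨n + 1, x⟩ : Σ n, P.cube n) ∈ P.star z := by
  obtain ⟨a, ha⟩ := h
  let b : Cell (n + 1) n := Cell.d k i (Cell.top (n + 1))
  let f : Hom (stdCube n) P := (P.sharp x).comp ((stdCube (n + 1)).sharp (n := n) b)
  have hf : f.app (Cell.top n) = P.d k i x := by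
    have h1 : (P.sharp x).app (n := n) b = P.d k i ((P.sharp x).app (Cell.top (n + 1))) :=
      (P.sharp x).app_d k i (Cell.top (n + 1))
    rw [sharp_top] at h1
    exact (congrArg (fun c => (P.sharp x).app c) (sharp_top (stdCube (n + 1)) b)).trans h1
  refine ⟨((stdCube (n + 1)).sharp (n := n) b).app a, ?_⟩
  have h := app_eq_sharp a f
  rw [hf] at h
  exact h.trans ha

/-- The precubical subset `P ∖ star(z)`. -/
def starCompl (P : PrecubicalSet.{u}) {m : ℕ} (z : P.cube m) : P.Sub where
  carrier n := {y | (⟨n, y⟩ : Σ n, P.cube n) ∉ P.star z}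
  d_mem k _ i x hx h := hx (P.mem_star_of_d_mem_star z k i x h)

/-! ### Geometric realization -/

/-- The topological sum of the spaces `P_n × [0,1]^n` with `P_n` discrete, i.e. of one copy of
`[0,1]^n` for each `n`-cube. -/
abbrev PreRealization (P : PrecubicalSet.{u}) : Type u :=
  Σ c : (Σ n, P.cube n), (Fin c.1 → unitInterval)

/-- The relation `(d^k_i x, u) ∼ (x, δ^k_i(u))`, where `δ^k_i` inserts `k` at the `i`-th place. -/
inductive GlueRel (P : PrecubicalSet.{u}) : P.PreRealization → P.PreRealization → Prop
  | glue (k : Bool) {n : ℕ} (i : Fin (n + 1)) (x : P.cube (n + 1)) (t : Fin n → unitInterval) :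
    GlueRel P ⟨⟨n, P.d k i x⟩, t⟩
      ⟨⟨n + 1, x⟩, i.insertNth (α := fun _ => unitInterval) (if k then 1 else 0) t⟩

/-- The geometric realization `|P|`, with the quotient topology; `Quot` is the quotient by the
equivalence relation generated by the given relation. -/
def Realization (P : PrecubicalSet.{u}) : Type u := Quot P.GlueRel

instance (P : PrecubicalSet.{u}) : TopologicalSpace P.Realization :=
  inferInstanceAs (TopologicalSpace (Quot P.GlueRel))

/-- The map `|f| : |P| → |Q|`, `[x, u] ↦ [f(x), u]`. -/
def Hom.realization {P : PrecubicalSet.{u}} {Q : PrecubicalSet.{v}} (f : Hom P Q) :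
    C(P.Realization, Q.Realization) where
  toFun := Quot.map (fun p => ⟨⟨p.1.1, f.app p.1.2⟩, p.2⟩) (by
    rintro _ _ ⟨k, i, x, t⟩
    change Q.GlueRel ⟨⟨_, f.app (P.d k i x)⟩, t⟩ _
    rw [f.app_d]
    exact GlueRel.glue k i (f.app x) t)
  continuous_toFun := by
    refine continuous_quot_lift _ (continuous_quot_mk.comp ?_)
    exact continuous_sigma fun c =>
      continuous_sigmaMk (σ := fun c : (Σ n, Q.cube n) => Fin c.1 → unitInterval)
        (i := ⟨c.1, f.app c.2⟩)

/-! ### The homology graph -/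

/-- The singular homology `H_n(|P|; R)` of the geometric realization. -/
noncomputable def homology (R : Type v) [CommRing R] (P : PrecubicalSet.{u}) (n : ℕ) :
    ModuleCat.{max u v} R :=
  ((AlgebraicTopology.singularHomologyFunctor.{u} (ModuleCat.{max u v} R) n).obj
    (ModuleCat.of R (ULift.{u} R))).obj (TopCat.of P.Realization)

/-- The homomorphism `H_n(|P|; R) → H_n(|Q|; R)` induced by a morphism. -/
noncomputable def Hom.homologyMap (R : Type v) [CommRing R] {P Q : PrecubicalSet.{u}} (f : Hom P Q)
    (n : ℕ) : P.homology R n ⟶ Q.homology R n :=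
  ((AlgebraicTopology.singularHomologyFunctor.{u} (ModuleCat.{max u v} R) n).obj
    (ModuleCat.of R (ULift.{u} R))).map (TopCat.ofHom f.realization)

/-- The homology classes of `|P|`: elements of `H_n(|P|; R)` for some degree `n`. -/
def HomologyClass (R : Type v) [CommRing R] (P : PrecubicalSet.{u}) : Type (max u v) :=
  Σ n : ℕ, P.homology R n

/-- The map `f_*` on homology classes induced by a morphism. -/
noncomputable def Hom.homologyClassMap (R : Type v) [CommRing R] {P Q : PrecubicalSet.{u}}
    (f : Hom P Q) (α : P.HomologyClass R) : Q.HomologyClass R :=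
  ⟨α.1, (f.homologyMap R α.1).hom α.2⟩

/-- `α ↗ β` (`α` points to `β`): there are precubical subsets `X, Y ⊆ P` such that
`α ∈ im H_*(|X| ↪ |P|)`, `β ∈ im H_*(|Y| ↪ |P|)`, and `x →_P y` for all vertices `x` of `X` and
`y` of `Y`. -/
def PointsTo (R : Type v) [CommRing R] (P : PrecubicalSet.{u}) (α β : P.HomologyClass R) : Prop :=
  ∃ X Y : P.Sub, α ∈ Set.range (X.incl.homologyClassMap R) ∧
    β ∈ Set.range (Y.incl.homologyClassMap R) ∧
    ∀ x ∈ X.carrier 0, ∀ y ∈ Y.carrier 0, P.Accessible x y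

/-- The map `f_*` induced by a morphism `f : Q → P` is an isomorphism from the homology graph of `Q`
(vertices: homology classes, edges: the relation `↗`) to the homology graph of `P`. -/
def Hom.IsHomologyGraphIso (R : Type v) [CommRing R] {Q P : PrecubicalSet.{u}} (f : Hom Q P) :
    Prop :=
  Function.Bijective (f.homologyClassMap R) ∧
    ∀ α β : Q.HomologyClass R,
      Q.PointsTo R α β ↔ P.PointsTo R (f.homologyClassMap R α) (f.homologyClassMap R β)

end PrecubicalSet

/-! Put `Q = P ∖ star(d^k_i x)`. Since `x` is regular, its faces are pairwise distinct, so all of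
them except `d^k_i x` lie in `Q`; as the face is free, `|P|` arises from `|Q|` by gluing a cube
along an open box (`exists_extension`). Projecting the cube radially onto the open box makes `|Q|` a
deformation retract of `|P|`, whence the bijection on homology classes
(`homologyClassMap_incl_starCompl_bijective`).

For the relation `↗`, read edges in the direction of `k` (reversed if `k = 0`). Let `w` be the
initial corner of `x` and `v` that of `d^k_i x`. The edge `e = e^k_i x` leads from `w` to `v`, and
by hypothesis no other edge ends in `v`. Relations in `Q` pass to `P` by inclusion. Conversely, a
path of `P` that starts outside `v` can be moved into `Q`: it enters `v` only from `w` along `e`,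
and if `x` is a square, a passage through the lost edge is replaced by the other way round the
square (`reach_starCompl_aux`).

Precubical subsets `X`, `Y` with `X → Y` are moved into `Q` by adding `x` where they contain `d^k_i
x` and collapsing (`exists_sub_starCompl`). The new vertices cause no harm: those added to `X` lead
to the final corner of `d^k_i x`, and those added to `Y` are reachable from `w`, through which every
path from outside to `v` passes. The remaining difficulty is `v` as a starting vertex in `X`. If an
edge of `X` leaves `v`, follow it. Otherwise weak regularity shows that `v` is a free face of `e` in
`X ∪ {e, w}`, and collapsing `e` replaces `v` by `w` (`exists_sub_of_corner_mem`). These cases are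
combined in `exists_subs_reach`. -/

open CategoryTheory

namespace PrecubicalSet

/-! ### Homotopy invariance -/

theorem Hom.realization_comp {P : PrecubicalSet.{u}} {Q : PrecubicalSet.{v}}
    {S : PrecubicalSet.{w}} (g : Hom Q S) (f : Hom P Q) :
    (g.comp f).realization = g.realization.comp f.realization := by
  ext p
  induction p using Quot.ind
  rfl

theorem Hom.homologyClassMap_comp (R : Type v) [CommRing R] {P Q S : PrecubicalSet.{u}}
    (g : Hom Q S) (f : Hom P Q) (α : P.HomologyClass R) :
    (g.comp f).homologyClassMap R α = g.homologyClassMap R (f.homologyClassMap R α) := by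
  have h : (g.comp f).homologyMap R α.1 = f.homologyMap R α.1 ≫ g.homologyMap R α.1 := by
    unfold Hom.homologyMap
    rw [Hom.realization_comp, TopCat.ofHom_comp, CategoryTheory.Functor.map_comp]
    rfl
  simp only [Hom.homologyClassMap, h]
  rfl

/-- Homotopic maps induce the same homomorphism in singular homology. -/
theorem singularHomology_map_eq_of_homotopic (R : Type v) [CommRing R] {X Y : TopCat.{u}}
    {f g : C(X, Y)} (H : f.Homotopic g) (n : ℕ) :
    ((AlgebraicTopology.singularHomologyFunctor.{u} (ModuleCat.{max u v} R) n).obj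
      (ModuleCat.of R (ULift.{u} R))).map (TopCat.ofHom f) =
    ((AlgebraicTopology.singularHomologyFunctor.{u} (ModuleCat.{max u v} R) n).obj
      (ModuleCat.of R (ULift.{u} R))).map (TopCat.ofHom g) :=
  TopCat.Homotopy.congr_homologyMap_singularChainComplexFunctor
    (f := TopCat.ofHom f) (g := TopCat.ofHom g) H.some (ModuleCat.of R (ULift.{u} R)) n

/-- A morphism whose realization is a homotopy equivalence is bijective on homology classes. -/
theorem Hom.homologyClassMap_bijective (R : Type v) [CommRing R] {P Q : PrecubicalSet.{u}}
    (f : Hom P Q) (r : C(Q.Realization, P.Realization))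
    (h₁ : (r.comp f.realization).Homotopic (ContinuousMap.id _))
    (h₂ : (f.realization.comp r).Homotopic (ContinuousMap.id _)) :
    Function.Bijective (f.homologyClassMap R) := by
  have key : ∀ n, Function.Bijective (f.homologyMap R n).hom := by
    intro n
    let F := (AlgebraicTopology.singularHomologyFunctor.{u} (ModuleCat.{max u v} R) n).obj
      (ModuleCat.of R (ULift.{u} R))
    let ρ : Q.homology R n ⟶ P.homology R n := F.map (TopCat.ofHom r)
    have e₁ : f.homologyMap R n ≫ ρ = 𝟙 _ := by
      have := singularHomology_map_eq_of_homotopic R (X := TopCat.of P.Realization)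
        (Y := TopCat.of P.Realization) h₁ n
      rw [TopCat.ofHom_comp, CategoryTheory.Functor.map_comp, TopCat.ofHom_id] at this
      exact this.trans (F.map_id _)
    have e₂ : ρ ≫ f.homologyMap R n = 𝟙 _ := by
      have := singularHomology_map_eq_of_homotopic R (X := TopCat.of Q.Realization)
        (Y := TopCat.of Q.Realization) h₂ n
      rw [TopCat.ofHom_comp, CategoryTheory.Functor.map_comp, TopCat.ofHom_id] at this
      exact this.trans (F.map_id _)
    refine ⟨Function.LeftInverse.injective (g := ρ.hom) fun a => ?_,
      Function.RightInverse.surjective (g := ρ.hom) fun a => ?_⟩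
    · exact congrArg (fun φ => φ.hom a) e₁
    · exact congrArg (fun φ => φ.hom a) e₂
  refine ⟨?_, ?_⟩
  · rintro ⟨m, a⟩ ⟨m', b⟩ h
    obtain rfl : m = m' := congrArg Sigma.fst h
    exact congrArg (Sigma.mk m) ((key m).1 (eq_of_heq (Sigma.mk.inj h).2))
  · rintro ⟨m, b⟩
    obtain ⟨a, rfl⟩ := (key m).2 b
    exact ⟨⟨m, a⟩, rfl⟩

end PrecubicalSet

namespace PrecubicalSet

/-! ### Maps out of the realization of a set with a free face -/

/-- The endpoint `k` of the unit interval. -/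
abbrev endpoint (k : Bool) : unitInterval := if k then 1 else 0

theorem endpoint_injective : Function.Injective endpoint := by
  intro k l h
  cases k <;> cases l <;> simp_all [endpoint]

/-- The point of `|P|` with coordinates `t` in the cube `x`. -/
def point (P : PrecubicalSet.{u}) {n : ℕ} (x : P.cube n) (t : Fin n → unitInterval) :
    P.Realization :=
  Quot.mk _ ⟨⟨n, x⟩, t⟩

theorem continuous_point (P : PrecubicalSet.{u}) {n : ℕ} (x : P.cube n) :
    Continuous (P.point x) :=
  continuous_quot_mk.comp (continuous_sigmaMk
    (σ := fun c : (Σ n, P.cube n) => Fin c.1 → unitInterval) (i := ⟨n, x⟩))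

theorem point_d (P : PrecubicalSet.{u}) (k : Bool) {n : ℕ} (i : Fin (n + 1))
    (x : P.cube (n + 1)) (t : Fin n → unitInterval) :
    P.point (P.d k i x) t = P.point x (i.insertNth (α := fun _ => unitInterval) (endpoint k) t) :=
  Quot.sound (GlueRel.glue k i x t)

theorem realization_point {P : PrecubicalSet.{u}} {Q : PrecubicalSet.{v}} (f : Hom P Q) {n : ℕ}
    (x : P.cube n) (t : Fin n → unitInterval) :
    f.realization (P.point x t) = Q.point (f.app x) t := rfl

theorem exists_point (P : PrecubicalSet.{u}) (p : P.Realization) :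
    ∃ (n : ℕ) (x : P.cube n) (t : Fin n → unitInterval), p = P.point x t := by
  induction p using Quot.ind with
  | mk p => exact ⟨p.1.1, p.1.2, p.2, rfl⟩

/-- Universal property of the quotient. `Z` is arbitrary, so that it can also be a space of paths;
homotopies are obtained in this way. -/
theorem exists_lift (P : PrecubicalSet.{u}) {Z : Type w} [TopologicalSpace Z]
    (φ : ∀ c : Σ n, P.cube n, C(Fin c.1 → unitInterval, Z))
    (hφ : ∀ (k : Bool) {n : ℕ} (i : Fin (n + 1)) (x : P.cube (n + 1)) (t : Fin n → unitInterval),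
      φ ⟨n, P.d k i x⟩ t =
        φ ⟨n + 1, x⟩ (i.insertNth (α := fun _ => unitInterval) (endpoint k) t)) :
    ∃ F : C(P.Realization, Z), ∀ {n : ℕ} (x : P.cube n) (t : Fin n → unitInterval),
      F (P.point x t) = φ ⟨n, x⟩ t := by
  refine ⟨⟨Quot.lift (fun p => φ p.1 p.2) ?_, ?_⟩, fun x t => rfl⟩
  · rintro _ _ ⟨k, i, x, t⟩
    exact hφ k i x t
  · exact continuous_quot_lift _ (continuous_sigma fun c => (φ c).continuous)

/-- Exchanging two successive face operators. -/
theorem d_d_succAbove (P : PrecubicalSet.{u}) (k l : Bool) {n : ℕ} (i : Fin (n + 2))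
    (j : Fin (n + 1)) (x : P.cube (n + 2)) :
    P.d l j (P.d k i x) = P.d k (j.predAbove i) (P.d l (i.succAbove j) x) := by
  rcases lt_or_ge j.castSucc i with h | h
  · rw [Fin.succAbove_of_castSucc_lt _ _ h, Fin.predAbove_of_castSucc_lt _ _ h]
    obtain ⟨i, rfl⟩ := (Fin.exists_succ_eq (x := i)).2 (Fin.ne_zero_of_lt h)
    simpa using P.d_d l k j i (Fin.le_castSucc_iff.2 h) x
  · rw [Fin.succAbove_of_le_castSucc _ _ h, Fin.predAbove_of_le_castSucc _ _ h]
    obtain ⟨i, rfl⟩ := Fin.exists_castSucc_eq.2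
      (fun e : i = Fin.last _ => absurd (e ▸ h) (not_le.2 (Fin.castSucc_lt_last j)))
    simpa using (P.d_d k l i j (by simpa using h) x).symm

/-- The coface identity dual to `d_d_succAbove`, with the same indices, so that the two can be
matched in gluing arguments. -/
theorem insertNth_insertNth {α : Type*} {n : ℕ} (i : Fin (n + 2)) (j : Fin (n + 1)) (a b : α)
    (t : Fin n → α) :
    i.insertNth (α := fun _ => α) a (j.insertNth (α := fun _ => α) b t) =
      (i.succAbove j).insertNth (α := fun _ => α) b
        ((j.predAbove i).insertNth (α := fun _ => α) a t) := by
  rw [Fin.eq_insertNth_iff]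
  refine ⟨by simp, ?_⟩
  rw [Fin.eq_insertNth_iff]
  refine ⟨?_, ?_⟩
  · simp [Fin.removeNth, Fin.succAbove_succAbove_predAbove]
  · rw [← Fin.removeNth_removeNth_eq_swap]
    simp

/-- The only vertex entry of `d^k_i ι` is `k`, in position `i`; both can be read off. -/
theorem Cell.d_top_injective (k l : Bool) : ∀ {n : ℕ} (i j : Fin (n + 1)),
    Cell.d k i (Cell.top (n + 1)) = Cell.d l j (Cell.top (n + 1)) → k = l ∧ i = j := by
  intro n
  induction n with
  | zero =>
    intro i j h
    have hi : i = 0 := Fin.fin_one_eq_zero i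
    have hj : j = 0 := Fin.fin_one_eq_zero j
    subst hi hj
    simp only [Cell.top, Cell.d_zero_edge, Cell.vertex.injEq] at h
    exact ⟨h.1, rfl⟩
  | succ n ih =>
    intro i j h
    rw [Cell.top] at h
    induction i using Fin.cases with
    | zero =>
      induction j using Fin.cases with
      | zero =>
        simp only [Cell.d_zero_edge, Cell.vertex.injEq] at h
        exact ⟨h.1, rfl⟩
      | succ j => simp at h
    | succ i =>
      induction j using Fin.cases with
      | zero => simp at h
      | succ j =>
        simp only [Cell.d_succ_edge, Cell.edge.injEq] at h
        obtain ⟨h₁, h₂⟩ := ih i j h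
        exact ⟨h₁, by rw [h₂]⟩

/-- The faces of a regular cube are pairwise distinct. -/
theorem Regular.d_injective {P : PrecubicalSet.{u}} {n : ℕ} {x : P.cube (n + 1)}
    (hx : P.Regular x) {k l : Bool} {i j : Fin (n + 1)} (h : P.d k i x = P.d l j x) :
    k = l ∧ i = j := by
  apply Cell.d_top_injective k l i j
  apply hx n
  have e : ∀ (k : Bool) (i : Fin (n + 1)),
      (P.sharp x).app (n := n) (Cell.d k i (Cell.top (n + 1))) = P.d k i x := fun k i =>
    ((P.sharp x).app_d k i (Cell.top (n + 1))).trans (by rw [sharp_top])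
  rw [e, e, h]

theorem self_mem_star (P : PrecubicalSet.{u}) {n : ℕ} (x : P.cube n) :
    (⟨n, x⟩ : Σ n, P.cube n) ∈ P.star x :=
  ⟨Cell.top n, sharp_top P x⟩

variable {P : PrecubicalSet.{u}} {n : ℕ} {x : P.cube (n + 1)} {k : Bool} {i : Fin (n + 1)}

/-- The faces of `x` other than `d^k_i x` do not lie in the star of `d^k_i x`. -/
theorem d_mem_starCompl (hx : P.Regular x)
    (hfree : P.star (P.d k i x) ⊆ {⟨n + 1, x⟩, ⟨n, P.d k i x⟩}) {l : Bool} {j : Fin (n + 1)}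
    (h : ¬(l = k ∧ j = i)) : P.d l j x ∈ (P.starCompl (P.d k i x)).carrier n := by
  intro hm
  rcases hfree hm with e | e
  · exact absurd (congrArg Sigma.fst e) (by simp)
  · exact h (hx.d_injective (eq_of_heq (Sigma.mk.inj e).2))

/-- The realization of `P` is the pushout of the realization of the complement of `star(d^k_i x)`
and of the cube `x`. -/
theorem exists_extension (hx : P.Regular x)
    (hfree : P.star (P.d k i x) ⊆ {⟨n + 1, x⟩, ⟨n, P.d k i x⟩})
    {Z : Type w} [TopologicalSpace Z]
    (g : C((P.starCompl (P.d k i x)).toPrecubicalSet.Realization, Z))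
    (f : C(Fin (n + 1) → unitInterval, Z))
    (hfg : ∀ (l : Bool) (j : Fin (n + 1)) (h : ¬(l = k ∧ j = i)) (t : Fin n → unitInterval),
      f (j.insertNth (α := fun _ => unitInterval) (endpoint l) t) =
        g (point _ ⟨P.d l j x, d_mem_starCompl hx hfree h⟩ t)) :
    ∃ F : C(P.Realization, Z),
      F.comp (P.starCompl (P.d k i x)).incl.realization = g ∧ ∀ t, F (P.point x t) = f t := by
  classical
  have star_mem : ∀ {m : ℕ} (y : P.cube m),
      y ∈ (P.starCompl (P.d k i x)).carrier m ↔
        ¬ ((⟨m, y⟩ : Σ n, P.cube n) = ⟨n + 1, x⟩ ∨ (⟨m, y⟩ : Σ n, P.cube n) = ⟨n, P.d k i x⟩) := by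
    intro m y
    refine ⟨fun h => ?_, fun h hy => h (hfree hy)⟩
    rintro (e | e)
    · exact h (e ▸ P.mem_star_of_d_mem_star _ k i x (P.self_mem_star _))
    · exact h (e ▸ P.self_mem_star _)
  let fD : C(Fin n → unitInterval, Z) :=
    f.comp ⟨fun t => i.insertNth (α := fun _ => unitInterval) (endpoint k) t,
      continuous_const.finInsertNth i continuous_id⟩
  let φ : ∀ c : Σ n, P.cube n, C(Fin c.1 → unitInterval, Z) := fun c =>
    if h : c = ⟨n + 1, x⟩ then h ▸ f
    else if h' : c = ⟨n, P.d k i x⟩ then h' ▸ fD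
    else g.comp ⟨_, continuous_point _ (⟨c.2, (star_mem c.2).2 (not_or.2 ⟨h, h'⟩)⟩ :
      (P.starCompl (P.d k i x)).toPrecubicalSet.cube c.1)⟩
  have φx : φ ⟨n + 1, x⟩ = f := dif_pos rfl
  have φD : φ ⟨n, P.d k i x⟩ = fD := by
    have h : (⟨n, P.d k i x⟩ : Σ n, P.cube n) ≠ ⟨n + 1, x⟩ := fun e =>
      absurd (congrArg Sigma.fst e) (by simp)
    exact (dif_neg h).trans (dif_pos rfl)
  have φQ : ∀ {m : ℕ} (y : P.cube m) (hy : y ∈ (P.starCompl (P.d k i x)).carrier m) t,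
      φ ⟨m, y⟩ t = g (point _ (⟨y, hy⟩ :
        (P.starCompl (P.d k i x)).toPrecubicalSet.cube m) t) := by
    intro m y hy t
    have h := not_or.1 ((star_mem y).1 hy)
    have : φ ⟨m, y⟩ = _ := (dif_neg h.1).trans (dif_neg h.2)
    rw [this]
    rfl
  obtain ⟨F, hF⟩ := P.exists_lift φ (by
    intro l m j y t
    by_cases hy : y ∈ (P.starCompl (P.d k i x)).carrier (m + 1)
    · rw [φQ y hy, φQ _ ((P.starCompl (P.d k i x)).d_mem l j y hy)]
      exact congrArg g (point_d (P.starCompl (P.d k i x)).toPrecubicalSet l j ⟨y, hy⟩ t)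
    · rw [star_mem, not_not] at hy
      rcases hy with e | e
      · obtain rfl : m = n := by simpa using congrArg Sigma.fst e
        obtain rfl : y = x := eq_of_heq (Sigma.mk.inj e).2
        rw [φx]
        by_cases h : l = k ∧ j = i
        · obtain ⟨rfl, rfl⟩ := h
          rw [φD]
          rfl
        · rw [φQ _ (d_mem_starCompl hx hfree h), hfg l j h]
      · obtain rfl : m + 1 = n := congrArg Sigma.fst e
        obtain rfl : y = P.d k i x := eq_of_heq (Sigma.mk.inj e).2
        -- A face of `d^k_i x` is also a face of a face of `x` with index `i.succAbove j ≠ i`, and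
        -- there `hfg` applies.
        have h : ¬ (l = k ∧ i.succAbove j = i) := fun h => Fin.succAbove_ne i j h.2
        have hm : P.d l j (P.d k i x) ∈ (P.starCompl (P.d k i x)).carrier m := by
          rw [star_mem]
          rintro (e | e) <;> exact absurd (congrArg Sigma.fst e) (by simp; try omega)
        rw [φD, φQ _ hm]
        change _ = f (i.insertNth (α := fun _ => unitInterval) (endpoint k)
          (j.insertNth (α := fun _ => unitInterval) (endpoint l) t))
        rw [insertNth_insertNth, hfg l _ h, ← point_d]
        congr 2
        exact Subtype.ext (P.d_d_succAbove k l i j x))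
  refine ⟨F, ?_, fun t => by rw [hF, φx]⟩
  ext p
  obtain ⟨m, y, t, rfl⟩ := exists_point _ p
  rw [ContinuousMap.comp_apply, realization_point, hF]
  exact φQ y.1 y.2 t

/-- A map on `|P|` is determined by its values on the complement of `star(d^k_i x)` and on `x`. -/
theorem continuousMap_ext_of_free
    (hfree : P.star (P.d k i x) ⊆ {⟨n + 1, x⟩, ⟨n, P.d k i x⟩})
    {Z : Type w} [TopologicalSpace Z] {F G : C(P.Realization, Z)}
    (hQ : F.comp (P.starCompl (P.d k i x)).incl.realization =
      G.comp (P.starCompl (P.d k i x)).incl.realization)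
    (hcube : ∀ t, F (P.point x t) = G (P.point x t)) : F = G := by
  ext p
  obtain ⟨m, y, t, rfl⟩ := exists_point _ p
  by_cases hy : y ∈ (P.starCompl (P.d k i x)).carrier m
  · exact DFunLike.congr_fun hQ (point (P.starCompl (P.d k i x)).toPrecubicalSet ⟨y, hy⟩ t)
  · rcases hfree (not_not.1 hy) with e | e
    · obtain rfl : m = n + 1 := congrArg Sigma.fst e
      obtain rfl : y = x := eq_of_heq (Sigma.mk.inj e).2
      exact hcube t
    · obtain rfl : m = n := congrArg Sigma.fst e
      obtain rfl : y = P.d k i x := eq_of_heq (Sigma.mk.inj e).2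
      rw [point_d]
      exact hcube _

end PrecubicalSet

namespace PrecubicalSet

/-! ### Collapsing a cube onto the faces other than a given one -/

section Cube

variable {n : ℕ} (k : Bool) (i : Fin (n + 1))

/-- The centre of the radial projection of a cube: it lies beyond the face `t_i = k`. -/
noncomputable def projCenter (j : Fin (n + 1)) : ℝ :=
  if j = i then (if k then 2 else -1) else 1 / 2

/-- The `j`-th coordinate relative to `projCenter`, scaled to be at most `1` in absolute value on
the cube. -/
noncomputable def relCoord (t : Fin (n + 1) → unitInterval) (j : Fin (n + 1)) : ℝ :=
  (t j - projCenter k i j) * (if j = i then 1 / 2 else 2)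

/-- The weighted distance from `projCenter`. -/
noncomputable def projGauge (t : Fin (n + 1) → unitInterval) : ℝ :=
  ‖relCoord k i t‖

/-- The union of the faces of the cube other than `t_i = k`. -/
def openBox : Set (Fin (n + 1) → unitInterval) :=
  {t | ∃ (l : Bool) (j : Fin (n + 1)), ¬(l = k ∧ j = i) ∧ t j = endpoint l}

variable {k i}

theorem abs_relCoord_le (t : Fin (n + 1) → unitInterval) (j : Fin (n + 1)) :
    |relCoord k i t j| ≤ 1 := by
  have h₀ := (t j).2.1
  have h₁ := (t j).2.2
  unfold relCoord projCenter
  rw [abs_le]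
  split_ifs <;> constructor <;> linarith

/-- The centre has distance 1 from the cube in direction `i`, and this coordinate is scaled by 1/2.
Hence the gauge never vanishes and may be divided by. -/
theorem half_le_abs_relCoord (t : Fin (n + 1) → unitInterval) :
    1 / 2 ≤ |relCoord k i t i| := by
  have h₀ := (t i).2.1
  have h₁ := (t i).2.2
  unfold relCoord projCenter
  cases k
  · exact le_trans (by simp; linarith) (le_abs_self _)
  · exact le_trans (by simp; linarith) (neg_le_abs _)

theorem half_le_projGauge (t : Fin (n + 1) → unitInterval) : 1 / 2 ≤ projGauge k i t :=
  (half_le_abs_relCoord t).trans (norm_le_pi_norm (relCoord k i t) i)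

theorem projGauge_pos (t : Fin (n + 1) → unitInterval) : 0 < projGauge k i t :=
  lt_of_lt_of_le (by norm_num) (half_le_projGauge t)

theorem projGauge_le_one (t : Fin (n + 1) → unitInterval) : projGauge k i t ≤ 1 :=
  (pi_norm_le_iff_of_nonneg zero_le_one).2 (abs_relCoord_le t)

theorem continuous_projGauge : Continuous (projGauge (n := n) k i) := by
  unfold projGauge relCoord
  fun_prop

/-- The scaling is chosen for this: in direction `i` the value 1 is attained only at the far end `1
- k`, in the other directions at both ends. So the unit sphere of the gauge meets the cube exactly
in the open box. -/
theorem abs_relCoord_eq_one_iff {t : Fin (n + 1) → unitInterval} {j : Fin (n + 1)} :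
    |relCoord k i t j| = 1 ↔ ∃ l, ¬(l = k ∧ j = i) ∧ t j = endpoint l := by
  have h₀ := (t j).2.1
  have h₁ := (t j).2.2
  have e₀ : t j = endpoint false ↔ (t j : ℝ) = 0 := Subtype.ext_iff
  have e₁ : t j = endpoint true ↔ (t j : ℝ) = 1 := Subtype.ext_iff
  unfold relCoord projCenter
  rw [abs_eq zero_le_one, Bool.exists_bool, e₀, e₁]
  generalize (t j : ℝ) = s at *
  by_cases hj : j = i
  · cases k
    · simp only [hj, if_true, and_true, not_true, false_and, false_or, Bool.false_eq_true,
        if_false, Bool.true_eq_false, not_false_iff, true_and]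
      exact ⟨fun h => by rcases h with h | h <;> linarith, fun h => .inl (by linarith)⟩
    · simp only [hj, if_true, and_true, not_true, false_and, or_false, Bool.false_eq_true,
        not_false_iff, true_and]
      exact ⟨fun h => by rcases h with h | h <;> linarith, fun h => .inr (by linarith)⟩
  · simp only [hj, if_false, and_false, not_false_iff, true_and]
    exact ⟨fun h => h.elim (fun h => .inr (by linarith)) fun h => .inl (by linarith),
      fun h => h.elim (fun h => .inr (by linarith)) fun h => .inl (by linarith)⟩

theorem projGauge_eq_one_of_mem {t : Fin (n + 1) → unitInterval} (ht : t ∈ openBox k i) :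
    projGauge k i t = 1 := by
  obtain ⟨l, j, h⟩ := ht
  refine le_antisymm (projGauge_le_one t) ?_
  rw [← abs_relCoord_eq_one_iff.2 ⟨l, h⟩]
  exact norm_le_pi_norm (relCoord k i t) j

/-- After division by the gauge every relative coordinate is at most 1 in absolute value, which
gives all bounds except the one at the end `k` in direction `i`. That one holds because the gauge is
at most 1: points move away from the centre. -/
theorem radial_mem (t : Fin (n + 1) → unitInterval) (j : Fin (n + 1)) :
    projCenter k i j + (t j - projCenter k i j) / projGauge k i t ∈ unitInterval := by
  have hM := projGauge_pos (k := k) (i := i) t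
  have hM₁ := projGauge_le_one (k := k) (i := i) t
  have hj : |relCoord k i t j| ≤ projGauge k i t := norm_le_pi_norm (relCoord k i t) j
  have h₀ := (t j).2.1
  have h₁ := (t j).2.2
  rw [abs_le] at hj
  unfold relCoord at hj
  generalize projGauge k i t = M at *
  generalize (t j : ℝ) = s at *
  have key : projCenter k i j + (s - projCenter k i j) / M =
      (projCenter k i j * M + (s - projCenter k i j)) / M := by field_simp
  rw [key]
  refine ⟨div_nonneg ?_ hM.le, (div_le_one hM).2 ?_⟩ <;>
  · unfold projCenter at *
    split_ifs at * <;> linarith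

variable (k i)

/-- The radial projection of the cube onto `openBox k i`. -/
noncomputable def radial (t : Fin (n + 1) → unitInterval) : Fin (n + 1) → unitInterval :=
  fun j => ⟨_, radial_mem (k := k) (i := i) t j⟩

variable {k i}

theorem continuous_radial : Continuous (radial (n := n) k i) := by
  refine continuous_pi fun j => Continuous.subtype_mk ?_ _
  have h := continuous_projGauge (n := n) (k := k) (i := i)
  exact continuous_const.add (Continuous.div (by fun_prop) h fun t => (projGauge_pos t).ne')

theorem radial_eq_self {t : Fin (n + 1) → unitInterval} (ht : t ∈ openBox k i) :
    radial k i t = t := by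
  funext j
  apply Subtype.ext
  simp [radial, projGauge_eq_one_of_mem ht]

/-- A coordinate that attains the maximum norm is scaled to absolute value 1. -/
theorem radial_mem_openBox (t : Fin (n + 1) → unitInterval) : radial k i t ∈ openBox k i := by
  obtain ⟨j, hj⟩ := (IsGreatest.pi_norm (relCoord k i t)).1
  have e : relCoord k i (radial k i t) j = relCoord k i t j / projGauge k i t := by
    simp only [relCoord, radial]
    ring
  have h : |relCoord k i (radial k i t) j| = 1 := by
    rw [e, abs_div, abs_of_pos (projGauge_pos t)]
    exact (congrArg (· / projGauge k i t) hj).trans (div_self (projGauge_pos t).ne')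
  obtain ⟨l, h⟩ := abs_relCoord_eq_one_iff.1 h
  exact ⟨l, j, h⟩

variable (k i)

/-- The straight-line homotopy from the identity to the radial projection. -/
noncomputable def radialHomotopy (t : Fin (n + 1) → unitInterval) (s : unitInterval) :
    Fin (n + 1) → unitInterval :=
  fun j => ⟨(1 - (s : ℝ)) * t j + s * radial k i t j,
    convex_Icc (0 : ℝ) 1 (t j).2 (radial k i t j).2 (sub_nonneg.2 s.2.2) s.2.1 (by ring)⟩

variable {k i}

theorem continuous_radialHomotopy :
    Continuous (Function.uncurry (radialHomotopy (n := n) k i)) := by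
  refine continuous_pi fun j => Continuous.subtype_mk ?_ _
  have h := continuous_radial (n := n) (k := k) (i := i)
  have h' : Continuous fun p : (Fin (n + 1) → unitInterval) × unitInterval =>
      ((radial k i p.1 j : unitInterval) : ℝ) :=
    continuous_subtype_val.comp ((continuous_apply j).comp (h.comp continuous_fst))
  exact Continuous.add (by fun_prop) (Continuous.mul (by fun_prop) h')

theorem radialHomotopy_zero (t : Fin (n + 1) → unitInterval) : radialHomotopy k i t 0 = t := by
  funext j; apply Subtype.ext; simp [radialHomotopy]

theorem radialHomotopy_one (t : Fin (n + 1) → unitInterval) :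
    radialHomotopy k i t 1 = radial k i t := by
  funext j; apply Subtype.ext; simp [radialHomotopy]

theorem radialHomotopy_of_mem {t : Fin (n + 1) → unitInterval} (ht : t ∈ openBox k i)
    (s : unitInterval) : radialHomotopy k i t s = t := by
  funext j; apply Subtype.ext; simp [radialHomotopy, radial_eq_self ht]; ring

end Cube

/-! ### The collapse -/

variable {P : PrecubicalSet.{u}} {n : ℕ} {x : P.cube (n + 1)} {k : Bool} {i : Fin (n + 1)}

/-- The points of two faces of `x` that agree in `x` agree in every precubical subset that contains
both faces. -/
theorem point_face_eq (Q : P.Sub) {l l' : Bool} {j j' : Fin (n + 1)}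
    (h : P.d l j x ∈ Q.carrier n) (h' : P.d l' j' x ∈ Q.carrier n)
    {t : Fin (n + 1) → unitInterval} (ht : t j = endpoint l) (ht' : t j' = endpoint l') :
    point Q.toPrecubicalSet ⟨P.d l j x, h⟩ (j.removeNth t) =
      point Q.toPrecubicalSet ⟨P.d l' j' x, h'⟩ (j'.removeNth t) := by
  rcases eq_or_ne j' j with rfl | hj
  · obtain rfl := endpoint_injective (ht.symm.trans ht')
    rfl
  -- Two faces in different directions meet in a face of codimension 2; both points come from there.
  · obtain ⟨q, rfl⟩ := Fin.exists_succAbove_eq hj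
    cases n with
    | zero => exact q.elim0
    | succ n =>
      have e₁ : j.removeNth t = q.insertNth (α := fun _ => unitInterval) (endpoint l')
          (q.removeNth (j.removeNth t)) := by
        rw [← ht']; exact (Fin.insertNth_self_removeNth q (j.removeNth t)).symm
      have e₂ : (j.succAbove q).removeNth t =
          (q.predAbove j).insertNth (α := fun _ => unitInterval) (endpoint l)
          (q.removeNth (j.removeNth t)) := by
        rw [Fin.removeNth_removeNth_eq_swap, ← ht]
        have := (Fin.insertNth_self_removeNth (q.predAbove j) ((j.succAbove q).removeNth t)).symm
        rwa [show (j.succAbove q).removeNth t (q.predAbove j) = t j from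
          congrArg t (Fin.succAbove_succAbove_predAbove j q)] at this
      rw [e₁, e₂]
      have f₁ := point_d Q.toPrecubicalSet l' q ⟨P.d l j x, h⟩ (q.removeNth (j.removeNth t))
      have f₂ := point_d Q.toPrecubicalSet l (q.predAbove j) ⟨P.d l' (j.succAbove q) x, h'⟩
        (q.removeNth (j.removeNth t))
      rw [← f₁, ← f₂]
      congr 1
      exact Subtype.ext (P.d_d_succAbove l l' j q x)

/-- The boundary of `x` without the free face maps to the complement of the star. -/
theorem exists_openBox_map (Q : P.Sub)
    (hQ : ∀ (l : Bool) (j : Fin (n + 1)), ¬(l = k ∧ j = i) → P.d l j x ∈ Q.carrier n) :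
    ∃ ρ : C(openBox k i, Q.toPrecubicalSet.Realization),
      ∀ (t : openBox k i) (l : Bool) (j : Fin (n + 1)) (h : ¬(l = k ∧ j = i)),
        t.1 j = endpoint l →
          ρ t = point Q.toPrecubicalSet ⟨P.d l j x, hQ l j h⟩ (j.removeNth t.1) := by
  choose l j h ht using fun t : openBox k i => t.2
  let ρ : openBox k i → Q.toPrecubicalSet.Realization := fun t =>
    point Q.toPrecubicalSet ⟨P.d (l t) (j t) x, hQ _ _ (h t)⟩ ((j t).removeNth t.1)
  have hρ : ∀ (t : openBox k i) (l : Bool) (j : Fin (n + 1)) (h : ¬(l = k ∧ j = i)),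
      t.1 j = endpoint l →
        ρ t = point Q.toPrecubicalSet ⟨P.d l j x, hQ l j h⟩ (j.removeNth t.1) :=
    fun t _ _ _ ht' => point_face_eq Q _ _ (ht t) ht'
  refine ⟨⟨ρ, ?_⟩, hρ⟩
  let S : {p : Bool × Fin (n + 1) // ¬(p.1 = k ∧ p.2 = i)} → Set (openBox k i) := fun p =>
    {t | t.1 p.1.2 = endpoint p.1.1}
  -- The chosen faces need not vary continuously, but the open box is a finite union of closed
  -- faces, and on each of them `hρ` allows a fixed choice.
  refine LocallyFinite.continuous (f := S) (locallyFinite_of_finite S) ?_ ?_ ?_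
  · exact Set.eq_univ_of_forall fun t => Set.mem_iUnion.2 ⟨⟨(l t, j t), h t⟩, ht t⟩
  · intro p
    exact isClosed_eq ((continuous_apply _).comp continuous_subtype_val) continuous_const
  · intro p
    refine ContinuousOn.congr (f := fun t : openBox k i =>
      point Q.toPrecubicalSet ⟨P.d p.1.1 p.1.2 x, hQ _ _ p.2⟩ (p.1.2.removeNth t.1)) ?_
      fun t ht' => hρ t _ _ p.2 ht'
    refine Continuous.continuousOn ((continuous_point _ _).comp ?_)
    exact continuous_pi fun q => (continuous_apply _).comp continuous_subtype_val

theorem insertNth_mem_openBox {l : Bool} {j : Fin (n + 1)} (h : ¬(l = k ∧ j = i))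
    (t : Fin n → unitInterval) :
    j.insertNth (α := fun _ => unitInterval) (endpoint l) t ∈ openBox k i :=
  ⟨l, j, h, by simp⟩

/-- If `x` is regular and `d^k_i x` is a face of `x` and itself only, then the complement of the
star of `d^k_i x` is a deformation retract. -/
theorem homologyClassMap_incl_starCompl_bijective (R : Type v) [CommRing R] (hx : P.Regular x)
    (hfree : P.star (P.d k i x) ⊆ {⟨n + 1, x⟩, ⟨n, P.d k i x⟩}) :
    Function.Bijective ((P.starCompl (P.d k i x)).incl.homologyClassMap R) := by
  set Q := P.starCompl (P.d k i x)
  obtain ⟨ρ, hρ⟩ := exists_openBox_map (x := x) (k := k) (i := i) Q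
    fun l j h => d_mem_starCompl hx hfree h
  obtain ⟨r, hr, hrx⟩ := exists_extension hx hfree (ContinuousMap.id _)
    (ρ.comp ⟨fun t => ⟨radial k i t, radial_mem_openBox t⟩,
      Continuous.subtype_mk continuous_radial _⟩) (by
      intro l j h t
      have hm := insertNth_mem_openBox (k := k) (i := i) h t
      have e : (⟨_, radial_mem_openBox _⟩ : openBox k i) = ⟨_, hm⟩ := Subtype.ext (radial_eq_self hm)
      change ρ ⟨_, _⟩ = _
      rw [e, hρ _ l j h (by simp)]
      simp only [Fin.removeNth_insertNth]
      rfl)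
  -- The homotopy is built in curried form, as a map from `|P|` to the path space, so that
  -- `exists_extension` applies without a quotient topology on `|P| × [0,1]`. On `|Q|` it is
  -- constant.
  let c : C(P.Realization, C(unitInterval, P.Realization)) :=
    ContinuousMap.curry ⟨Prod.fst, continuous_fst⟩
  obtain ⟨H, hH, hHx⟩ := exists_extension hx hfree (c.comp Q.incl.realization)
    (ContinuousMap.curry ⟨fun p => P.point x (radialHomotopy k i p.1 p.2),
      (continuous_point P x).comp continuous_radialHomotopy⟩) (by
      intro l j h t
      ext s
      change P.point x (radialHomotopy k i _ s) = P.point (P.d l j x) t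
      rw [radialHomotopy_of_mem (insertNth_mem_openBox h t), point_d])
  have hH' : ∀ q s, H (Q.incl.realization q) s = Q.incl.realization q := fun q s =>
    congrArg (fun φ => φ s) (DFunLike.congr_fun hH q)
  have hHx' : ∀ t s, H (P.point x t) s = P.point x (radialHomotopy k i t s) := fun t s =>
    congrArg (fun φ => φ s) (hHx t)
  have hr' : ∀ q, r (Q.incl.realization q) = q := fun q => DFunLike.congr_fun hr q
  have ev : ∀ s : unitInterval, Continuous fun p => H p s := fun s =>
    (continuous_eval_const s).comp H.continuous
  have H₀ : (⟨fun p => H p 0, ev 0⟩ : C(P.Realization, P.Realization)) = ContinuousMap.id _ := by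
    refine continuousMap_ext_of_free hfree ?_ fun t => ?_
    · ext q; exact hH' q 0
    · exact (hHx' t 0).trans (by rw [radialHomotopy_zero]; rfl)
  have H₁ : (⟨fun p => H p 1, ev 1⟩ : C(P.Realization, P.Realization)) =
      Q.incl.realization.comp r := by
    refine continuousMap_ext_of_free hfree ?_ fun t => ?_
    · ext q
      exact (hH' q 1).trans (congrArg Q.incl.realization (hr' q)).symm
    · refine (hHx' t 1).trans ?_
      rw [radialHomotopy_one, ContinuousMap.comp_apply, hrx]
      obtain ⟨l, j, h, e⟩ := radial_mem_openBox (k := k) (i := i) t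
      change _ = Q.incl.realization (ρ ⟨_, _⟩)
      rw [hρ _ l j h e, realization_point]
      change _ = P.point (P.d l j x) _
      rw [point_d, ← e]
      congr 1
      exact (Fin.insertNth_self_removeNth j _).symm
  refine Hom.homologyClassMap_bijective R _ r ?_ ?_
  · rw [hr]
  · refine ContinuousMap.Homotopic.symm ⟨⟨⟨fun p => H p.2 p.1, ?_⟩, ?_, ?_⟩⟩
    · exact (ContinuousMap.continuous_uncurry_of_continuous H).comp continuous_swap
    · exact fun p => DFunLike.congr_fun H₀ p
    · exact fun p => DFunLike.congr_fun H₁ p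

end PrecubicalSet

namespace PrecubicalSet

/-! ### Paths as chains of edges -/

/-- There is an edge from `a` to `b` (if `k = 1`), respectively from `b` to `a` (if `k = 0`). -/
def Step (P : PrecubicalSet.{u}) (k : Bool) (a b : P.cube 0) : Prop :=
  ∃ y : P.cube 1, P.d (!k) 0 y = a ∧ P.d k 0 y = b

/-- There is a path from `a` to `b` (if `k = 1`), respectively from `b` to `a` (if `k = 0`). -/
abbrev Reach (P : PrecubicalSet.{u}) (k : Bool) : P.cube 0 → P.cube 0 → Prop :=
  Relation.ReflTransGen (P.Step k)

/-- The path with given vertices and edges. -/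
def Hom.ofSeq {P : PrecubicalSet.{u}} {r : ℕ} (f : Fin (r + 1) → P.cube 0) (g : Fin r → P.cube 1)
    (h₀ : ∀ j, P.d false 0 (g j) = f j.castSucc) (h₁ : ∀ j, P.d true 0 (g j) = f j.succ) :
    Hom (interval r) P where
  app {n} := match n with
    | 0 => f
    | 1 => g
    | _ + 2 => fun y => Empty.elim y
  app_d k n i y := match n, i, y with
    | 0, i, y => by
      obtain rfl := Fin.fin_one_eq_zero i
      cases k
      · exact (h₀ y).symm
      · exact (h₁ y).symm
    | _ + 1, _, y => Empty.elim y

/-- This makes paths accessible to induction on their steps. -/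
theorem accessible_iff_reach (P : PrecubicalSet.{u}) (a b : P.cube 0) :
    P.Accessible a b ↔ P.Reach true a b := by
  constructor
  · rintro ⟨r, ω, rfl, rfl⟩
    have key : ∀ j : Fin (r + 1),
        P.Reach true (ω.app (interval.vertex 0)) (ω.app (interval.vertex j)) := by
      intro j
      induction j using Fin.induction with
      | zero => exact .refl
      | succ j ih =>
        let y : (interval r).cube 1 := j
        exact ih.tail ⟨ω.app y, (ω.app_d false 0 y).symm, (ω.app_d true 0 y).symm⟩
    exact key _
  · intro h
    suffices ∃ (r : ℕ) (f : Fin (r + 1) → P.cube 0) (g : Fin r → P.cube 1),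
        (∀ j, P.d false 0 (g j) = f j.castSucc) ∧ (∀ j, P.d true 0 (g j) = f j.succ) ∧
          f 0 = a ∧ f (Fin.last r) = b by
      obtain ⟨r, f, g, h₀, h₁, ha, hb⟩ := this
      exact ⟨r, Hom.ofSeq f g h₀ h₁, ha, hb⟩
    induction h using Relation.ReflTransGen.head_induction_on with
    | refl => exact ⟨0, fun _ => b, fun j => j.elim0, fun j => j.elim0, fun j => j.elim0, rfl, rfl⟩
    | head hs _ ih =>
      obtain ⟨y, hy₀, hy₁⟩ := hs
      obtain ⟨r, f, g, h₀, h₁, ha, hb⟩ := ih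
      refine ⟨r + 1, Fin.cons (P.d false 0 y) f, Fin.cons y g, ?_, ?_, hy₀, hb⟩
      · intro j
        induction j using Fin.cases with
        | zero => rfl
        | succ j => exact h₀ j
      · intro j
        induction j using Fin.cases with
        | zero => exact hy₁.trans ha.symm
        | succ j => exact h₁ j

theorem reach_false_iff (P : PrecubicalSet.{u}) (a b : P.cube 0) :
    P.Reach false a b ↔ P.Reach true b a := by
  have h : P.Step false = Function.swap (P.Step true) := by
    funext a b
    exact propext ⟨fun ⟨y, h, h'⟩ => ⟨y, h', h⟩, fun ⟨y, h, h'⟩ => ⟨y, h', h⟩⟩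
  rw [Reach, h]
  exact Relation.reflTransGen_swap

theorem Hom.reach {P : PrecubicalSet.{u}} {Q : PrecubicalSet.{v}} (f : Hom P Q) {k : Bool}
    {a b : P.cube 0} (h : P.Reach k a b) : Q.Reach k (f.app a) (f.app b) := by
  refine Relation.ReflTransGen.lift (fun c : P.cube 0 => f.app c) ?_ _ _ h
  rintro _ _ ⟨y, rfl, rfl⟩
  exact ⟨f.app y, (f.app_d _ _ _).symm, (f.app_d _ _ _).symm⟩

/-! ### Corners and edges of a cube -/

/-- The order in which the coordinates are set to `l` is irrelevant, since `d^l_1` can be moved past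
`d^l_j`. -/
theorem corner_d (P : PrecubicalSet.{u}) (l : Bool) : ∀ {n : ℕ} (j : Fin (n + 1))
    (x : P.cube (n + 1)), P.corner l (P.d l j x) = P.corner l x := by
  intro n
  induction n with
  | zero => intro j x; obtain rfl := Fin.fin_one_eq_zero j; rfl
  | succ n ih =>
    intro j x
    induction j using Fin.cases with
    | zero => rfl
    | succ j =>
      change P.corner l (P.d l 0 (P.d l j.succ x)) = _
      rw [P.d_d l l 0 j (Fin.zero_le j), ih]
      rfl

theorem Hom.app_corner {P : PrecubicalSet.{u}} {Q : PrecubicalSet.{v}} (f : Hom P Q) (l : Bool) :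
    ∀ {n : ℕ} (x : P.cube n), f.app (P.corner l x) = Q.corner l (f.app x) := by
  intro n
  induction n with
  | zero => intro x; rfl
  | succ n ih => intro x; exact (ih _).trans (congrArg _ (f.app_d l 0 x))

/-- Each operator in the recursion for `edge` is a `1 - k` face: it can be exchanged with `d^k_i`,
and by `corner_d` it does not affect the corner. -/
theorem d_edge (P : PrecubicalSet.{u}) (k : Bool) : ∀ {n : ℕ} (i : Fin (n + 1))
    (x : P.cube (n + 1)), P.d k 0 (P.edge k i x) = P.corner (!k) (P.d k i x) := by
  intro n
  induction n with
  | zero => intro i x; obtain rfl := Fin.fin_one_eq_zero i; rfl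
  | succ n ih =>
    intro i x
    rw [edge]
    split_ifs with h
    · subst h
      rw [ih, ← P.d_d (!k) k (Fin.last n) (Fin.last n) le_rfl, corner_d]
      rfl
    · rw [ih]
      obtain ⟨i, rfl⟩ := Fin.exists_castSucc_eq.2 h
      have e := P.d_d k (!k) i (Fin.last n) (Fin.le_last i) x
      rw [Fin.succ_last] at e
      rw [Fin.castPred_castSucc, e, corner_d]

theorem d_not_edge (P : PrecubicalSet.{u}) (k : Bool) : ∀ {n : ℕ} (i : Fin (n + 1))
    (x : P.cube (n + 1)), P.d (!k) 0 (P.edge k i x) = P.corner (!k) x := by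
  intro n
  induction n with
  | zero => intro i x; rfl
  | succ n ih =>
    intro i x
    rw [edge]
    split_ifs with h <;> rw [ih, corner_d]

theorem Hom.app_edge {P : PrecubicalSet.{u}} {Q : PrecubicalSet.{v}} (f : Hom P Q) (k : Bool) :
    ∀ {n : ℕ} (i : Fin (n + 1)) (x : P.cube (n + 1)),
      f.app (P.edge k i x) = Q.edge k i (f.app x) := by
  intro n
  induction n with
  | zero => intro i x; rfl
  | succ n ih =>
    intro i x
    rw [edge, edge]
    split_ifs with h <;> rw [ih, f.app_d]

/-- The coordinates of `c` are adjusted one at a time: an entry `k` costs one edge in its direction,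
an entry `1 - k` costs nothing. -/
theorem reach_of_corner (k : Bool) : ∀ {m : ℕ} (c : Cell m 0) (P : PrecubicalSet.{u})
    (y : P.cube m), P.Reach k (P.corner (!k) y) (sharpFun c P y)
  | _, .nil, _, _ => .refl
  | _, .vertex l c, P, y => by
    have ih := reach_of_corner k c P (P.d l 0 y)
    by_cases h : l = k
    · subst h
      exact ih.head ⟨P.edge l 0 y, P.d_not_edge l 0 y, P.d_edge l 0 y⟩
    · obtain rfl : l = !k := Bool.eq_not_of_ne h
      exact ih

theorem reach_corner (k : Bool) : ∀ {m : ℕ} (c : Cell m 0) (P : PrecubicalSet.{u})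
    (y : P.cube m), P.Reach k (sharpFun c P y) (P.corner k y)
  | _, .nil, _, _ => .refl
  | _, .vertex l c, P, y => by
    have ih := reach_corner k c P (P.d l 0 y)
    by_cases h : l = k
    · subst h
      exact ih
    · obtain rfl : l = !k := Bool.eq_not_of_ne h
      have h₀ := P.d_edge (!k) 0 y
      have h₁ := P.d_not_edge (!k) 0 y
      rw [Bool.not_not] at h₀ h₁
      exact ih.tail ⟨P.edge (!k) 0 y, h₀, h₁⟩

theorem Cell.d_false_ne_d_true : ∀ {N m : ℕ} (c : Cell N (m + 1)),
    Cell.d false 0 c ≠ Cell.d true 0 c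
  | _, _, .vertex l c => by simpa using Cell.d_false_ne_d_true c
  | _, _, .edge c => by simp

/-- The vertex of the cube all of whose coordinates are `k`. -/
def Cell.const (k : Bool) : ∀ m : ℕ, Cell m 0
  | 0 => .nil
  | m + 1 => .vertex k (Cell.const k m)

theorem Cell.avoids_const {k l : Bool} (h : k ≠ l) : ∀ m, (Cell.const k m).Avoids l
  | 0 => trivial
  | m + 1 => ⟨h, Cell.avoids_const h m⟩

/-- If some entry is `1 - k`, replacing it by `[0,1]` gives an edge that begins in `c`. -/
theorem Cell.eq_const_or (k : Bool) : ∀ {m : ℕ} (c : Cell m 0),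
    c = Cell.const k m ∨ ∃ c' : Cell m 1, Cell.d (!k) 0 c' = c
  | _, .nil => .inl rfl
  | _, .vertex l c => by
    by_cases h : l = k
    · subst h
      rcases Cell.eq_const_or l c with rfl | ⟨c', rfl⟩
      · exact .inl rfl
      · exact .inr ⟨.vertex l c', by simp⟩
    · obtain rfl : l = !k := Bool.eq_not_of_ne h
      exact .inr ⟨.edge c, by simp⟩

/-- In a regular cube, an edge has distinct endpoints. -/
theorem Regular.corner_ne {P : PrecubicalSet.{u}} {n : ℕ} {x : P.cube (n + 1)} (hx : P.Regular x)
    (k : Bool) (i : Fin (n + 1)) : P.corner (!k) (P.d k i x) ≠ P.corner (!k) x := by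
  rw [← d_edge, ← d_not_edge P k i]
  intro h
  have e : (P.sharp x).app ((stdCube (n + 1)).edge k i (Cell.top (n + 1))) = P.edge k i x :=
    ((P.sharp x).app_edge k i (Cell.top (n + 1))).trans (by rw [sharp_top])
  rw [← e, ← Hom.app_d, ← Hom.app_d] at h
  have h' := hx 0 h
  cases k
  · exact Cell.d_false_ne_d_true _ h'
  · exact Cell.d_false_ne_d_true _ h'.symm

/-! ### Precubical subsets -/

variable {P : PrecubicalSet.{u}}

theorem Sub.sharpFun_mem (X : P.Sub) {n m : ℕ} (c : Cell n m) {y : P.cube n}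
    (hy : y ∈ X.carrier n) : sharpFun c P y ∈ X.carrier m := by
  have h := app_sharpFun c X.incl (⟨y, hy⟩ : X.toPrecubicalSet.cube n)
  have h' := (sharpFun c X.toPrecubicalSet ⟨y, hy⟩).2
  exact Eq.subst (motive := fun z => z ∈ X.carrier m) h h'

theorem Sub.corner_mem (X : P.Sub) (l : Bool) {n : ℕ} {y : P.cube n}
    (hy : y ∈ X.carrier n) : P.corner l y ∈ X.carrier 0 := by
  rw [show P.corner l y = (X.toPrecubicalSet.corner l (⟨y, hy⟩ : X.toPrecubicalSet.cube n)).1 from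
    (X.incl.app_corner l (⟨y, hy⟩ : X.toPrecubicalSet.cube n)).symm]
  exact (X.toPrecubicalSet.corner l (⟨y, hy⟩ : X.toPrecubicalSet.cube n)).2

/-- The inclusion of precubical subsets. -/
def Sub.inclusion {X Y : P.Sub} (h : ∀ m, X.carrier m ⊆ Y.carrier m) :
    Hom X.toPrecubicalSet Y.toPrecubicalSet where
  app y := ⟨y.1, h _ y.2⟩
  app_d _ _ _ _ := rfl

theorem Sub.range_mono (R : Type v) [CommRing R] {X Y : P.Sub}
    (h : ∀ m, X.carrier m ⊆ Y.carrier m) :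
    Set.range (X.incl.homologyClassMap R) ⊆ Set.range (Y.incl.homologyClassMap R) := by
  rintro _ ⟨α, rfl⟩
  exact ⟨(Sub.inclusion h).homologyClassMap R α,
    (Hom.homologyClassMap_comp R Y.incl (Sub.inclusion h) α).symm⟩

/-- The union of two precubical subsets. -/
def Sub.union (X Y : P.Sub) : P.Sub where
  carrier m := X.carrier m ∪ Y.carrier m
  d_mem k _ i x := Or.imp (X.d_mem k i x) (Y.d_mem k i x)

/-- The part of a precubical subset outside the star of `z`. -/
def Sub.diffStar (X : P.Sub) {m : ℕ} (z : P.cube m) : P.Sub where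
  carrier m := X.carrier m ∩ (P.starCompl z).carrier m
  d_mem k _ i x := And.imp (X.d_mem k i x) ((P.starCompl z).d_mem k i x)

/-- The precubical subset generated by a cube. -/
def cubeSub {n : ℕ} (x : P.cube n) : P.Sub where
  carrier m := Set.range fun c : Cell n m => sharpFun c P x
  d_mem k _ i y := by
    rintro ⟨c, rfl⟩
    exact ⟨Cell.d k i c, sharpFun_d k i c P x⟩

theorem self_mem_cubeSub {n : ℕ} (x : P.cube n) : x ∈ (cubeSub x).carrier n :=
  ⟨Cell.top n, sharp_top P x⟩

/-- By naturality of `y_♯`, stars in `X` are traces of stars in `P`. Thus a face only has to be free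
within `X` in order to be collapsed there. -/
theorem Sub.mem_star_iff (X : P.Sub) {m n : ℕ} (z : X.toPrecubicalSet.cube m)
    (y : X.toPrecubicalSet.cube n) :
    (⟨n, y⟩ : Σ n, X.toPrecubicalSet.cube n) ∈ X.toPrecubicalSet.star z ↔
      (⟨n, y.1⟩ : Σ n, P.cube n) ∈ P.star z.1 := by
  refine exists_congr fun c => ?_
  change sharpFun c X.toPrecubicalSet y = z ↔ sharpFun c P (X.incl.app y) = X.incl.app z
  rw [← app_sharpFun]
  exact Subtype.ext_iff

/-- Collapsing a free face inside a precubical subset `Z` does not change the image in homology. -/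
theorem Sub.range_subset_of_collapse (R : Type v) [CommRing R] {n : ℕ} {x : P.cube (n + 1)}
    {k : Bool} {i : Fin (n + 1)} (hx : P.Regular x) (Z : P.Sub) (hxZ : x ∈ Z.carrier (n + 1))
    (hfree : ∀ (m : ℕ) (z : P.cube m), z ∈ Z.carrier m → ⟨m, z⟩ ∈ P.star (P.d k i x) →
      (⟨m, z⟩ : Σ n, P.cube n) = ⟨n + 1, x⟩ ∨ (⟨m, z⟩ : Σ n, P.cube n) = ⟨n, P.d k i x⟩) :
    Set.range (Z.incl.homologyClassMap R) ⊆
      Set.range ((Z.diffStar (P.d k i x)).incl.homologyClassMap R) := by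
  let x' : Z.toPrecubicalSet.cube (n + 1) := ⟨x, hxZ⟩
  have hx' : Z.toPrecubicalSet.Regular x' := by
    intro m a b h
    apply hx m
    change sharpFun a P (Z.incl.app x') = sharpFun b P (Z.incl.app x')
    rw [← app_sharpFun, ← app_sharpFun]
    exact congrArg Z.incl.app h
  have hfree' : Z.toPrecubicalSet.star (Z.toPrecubicalSet.d k i x') ⊆
      {⟨n + 1, x'⟩, ⟨n, Z.toPrecubicalSet.d k i x'⟩} := by
    rintro ⟨m, z⟩ h
    rcases hfree m z.1 z.2 ((Z.mem_star_iff _ z).1 h) with e | e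
    · left
      obtain rfl : m = n + 1 := congrArg Sigma.fst e
      exact congrArg (Sigma.mk _) (Subtype.ext (eq_of_heq (Sigma.mk.inj e).2))
    · right
      obtain rfl : m = n := congrArg Sigma.fst e
      exact congrArg (Sigma.mk _) (Subtype.ext (eq_of_heq (Sigma.mk.inj e).2))
  let f : Hom (Z.toPrecubicalSet.starCompl (Z.toPrecubicalSet.d k i x')).toPrecubicalSet
      (Z.diffStar (P.d k i x)).toPrecubicalSet :=
    { app := fun y => ⟨y.1.1, y.1.2, fun h => y.2 ((Z.mem_star_iff _ y.1).2 h)⟩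
      app_d := fun _ _ _ _ => rfl }
  rintro _ ⟨α, rfl⟩
  obtain ⟨β, rfl⟩ := (homologyClassMap_incl_starCompl_bijective R hx' hfree').2 α
  refine ⟨f.homologyClassMap R β, ?_⟩
  rw [← Hom.homologyClassMap_comp, ← Hom.homologyClassMap_comp]
  rfl

end PrecubicalSet

namespace PrecubicalSet

/-! ### Pushing paths and precubical subsets off the star of a free face -/

variable {P : PrecubicalSet.{u}} {n : ℕ} {x : P.cube (n + 1)} {k : Bool} {i : Fin (n + 1)}

/-- The star contains a vertex only if `d^k_i x` is itself a vertex, and then it is its own corner.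
-/
theorem mem_starCompl_of_ne_corner
    (hfree : P.star (P.d k i x) ⊆ {⟨n + 1, x⟩, ⟨n, P.d k i x⟩}) {a : P.cube 0}
    (ha : a ≠ P.corner (!k) (P.d k i x)) : a ∈ (P.starCompl (P.d k i x)).carrier 0 := by
  intro h
  rcases hfree h with e | e
  · exact absurd (congrArg Sigma.fst e) (by simp)
  · obtain rfl : 0 = n := congrArg Sigma.fst e
    exact ha (eq_of_heq (Sigma.mk.inj e).2)

/-- If the edge were `x`, its endpoint would be the removed free face; if it were `d^k_i x`, it
would begin in both of the distinct corners `w` and `v`. -/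
theorem edge_mem_starCompl (hx : P.Regular x)
    (hfree : P.star (P.d k i x) ⊆ {⟨n + 1, x⟩, ⟨n, P.d k i x⟩})
    (hv : P.corner (!k) (P.d k i x) ∈ (P.starCompl (P.d k i x)).carrier 0) :
    P.edge k i x ∈ (P.starCompl (P.d k i x)).carrier 1 := by
  intro h
  rcases hfree h with e | e
  · obtain rfl : 0 = n := Nat.succ_injective (congrArg Sigma.fst e)
    exact hv (P.self_mem_star _)
  · obtain rfl : 1 = n := congrArg Sigma.fst e
    have e' : P.edge k i x = P.d k i x := eq_of_heq (Sigma.mk.inj e).2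
    apply hx.corner_ne k i
    rw [← P.d_not_edge k i x, e']
    rfl

theorem step_of_mem {Q : P.Sub} {y : P.cube 1} (hy : y ∈ Q.carrier 1) {a b : P.cube 0}
    (ha : P.d (!k) 0 y = a) (hb : P.d k 0 y = b) (haQ : a ∈ Q.carrier 0) (hbQ : b ∈ Q.carrier 0) :
    Q.toPrecubicalSet.Step k ⟨a, haQ⟩ ⟨b, hbQ⟩ :=
  ⟨⟨y, hy⟩, Subtype.ext ha, Subtype.ext hb⟩

/-- In a square, the corner opposite to the starting vertex of `d^k_i x` can be reached along the
two edges that do not contain that vertex. -/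
theorem reach_opposite_of_square {x : P.cube 2} {i : Fin 2} (hx : P.Regular x)
    (hfree : P.star (P.d k i x) ⊆ {⟨2, x⟩, ⟨1, P.d k i x⟩})
    (hw : P.corner (!k) x ∈ (P.starCompl (P.d k i x)).carrier 0)
    (hu : P.corner k x ∈ (P.starCompl (P.d k i x)).carrier 0) :
    (P.starCompl (P.d k i x)).toPrecubicalSet.Reach k ⟨P.corner (!k) x, hw⟩
      ⟨P.corner k x, hu⟩ := by
  -- The way round uses the edge opposite to `d^k_i x` and then the `k`-face in the other direction.
  have h₁ := d_mem_starCompl hx hfree (l := !k) (j := i) (by simp)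
  have h₂ := d_mem_starCompl hx hfree (l := k) (j := i.succAbove 0)
    (fun h => Fin.succAbove_ne i 0 h.2)
  have hm := (P.starCompl (P.d k i x)).d_mem k 0 _ h₁
  refine .tail (b := ⟨P.d k 0 (P.d (!k) i x), hm⟩) (.single ?_) ?_
  · exact step_of_mem h₁ (P.corner_d (!k) i x) rfl _ _
  · refine step_of_mem h₂ ?_ (P.corner_d k (i.succAbove 0) x) _ _
    rw [P.d_d_succAbove (!k) k i 0 x, Fin.fin_one_eq_zero (Fin.predAbove 0 i)]

/-- Paths of `P` that do not begin in the corner of the free face can be pushed off the star of the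
free face. -/
theorem reach_starCompl_aux (hx : P.Regular x)
    (hfree : P.star (P.d k i x) ⊆ {⟨n + 1, x⟩, ⟨n, P.d k i x⟩})
    (hedge : ∀ y : P.cube 1, P.d k 0 y = P.corner (!k) (P.d k i x) → y = P.edge k i x)
    {a c : P.cube 0} (ha : a ≠ P.corner (!k) (P.d k i x)) (h : P.Reach k a c) :
    (∀ hc : c ≠ P.corner (!k) (P.d k i x),
      (P.starCompl (P.d k i x)).toPrecubicalSet.Reach k
        ⟨a, mem_starCompl_of_ne_corner hfree ha⟩ ⟨c, mem_starCompl_of_ne_corner hfree hc⟩) ∧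
    (c = P.corner (!k) (P.d k i x) →
      (P.starCompl (P.d k i x)).toPrecubicalSet.Reach k
        ⟨a, mem_starCompl_of_ne_corner hfree ha⟩
        ⟨P.corner (!k) x, mem_starCompl_of_ne_corner hfree (hx.corner_ne k i).symm⟩) := by
  -- Invariant: while the path of `P` stands in `v`, the path of `Q` waits in `w`.
  induction h with
  | refl => exact ⟨fun _ => .refl, fun h => absurd h ha⟩
  | @tail c c' _ hs ih =>
    obtain ⟨y, hy₀, hy₁⟩ := hs
    refine ⟨fun hc' => ?_, fun hc' => ?_⟩
    · by_cases hy : y ∈ (P.starCompl (P.d k i x)).carrier 1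
      -- If the path leaves `v` along an edge of `Q`, then `v` and hence `e` lie in `Q`, and the
      -- waiting path catches up along `e`.
      · by_cases hc : c = P.corner (!k) (P.d k i x)
        · have hv := (P.starCompl (P.d k i x)).d_mem (!k) 0 y hy
          rw [hy₀, hc] at hv
          refine .tail (b := ⟨_, hv⟩) (.tail (ih.2 hc) ?_) ?_
          · exact step_of_mem (edge_mem_starCompl hx hfree hv) (P.d_not_edge k i x)
              (P.d_edge k i x) _ _
          · exact step_of_mem hy (hy₀.trans hc) hy₁ _ _
        · exact (ih.1 hc).tail (step_of_mem hy hy₀ hy₁ _ _)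
      · rcases hfree (not_not.1 hy) with e | e
        · obtain rfl : 0 = n := Nat.succ_injective (congrArg Sigma.fst e)
          obtain rfl : y = x := eq_of_heq (Sigma.mk.inj e).2
          obtain rfl := Fin.fin_one_eq_zero i
          exact absurd hy₁.symm hc'
        -- Here the path leaves `v` along the removed edge of a square; the waiting path goes from
        -- `w` round the other side.
        · obtain rfl : 1 = n := congrArg Sigma.fst e
          obtain rfl : y = P.d k i x := eq_of_heq (Sigma.mk.inj e).2
          obtain rfl : P.corner k x = c' := by rw [← hy₁, ← corner_d P k i x]; rfl
          exact (ih.2 hy₀.symm).trans (reach_opposite_of_square hx hfree _ _)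
    · have hy := hedge y (hy₁.trans hc')
      obtain rfl : P.corner (!k) x = c := by rw [← hy₀, hy, d_not_edge]
      exact ih.1 (hx.corner_ne k i).symm

theorem reach_starCompl (hx : P.Regular x)
    (hfree : P.star (P.d k i x) ⊆ {⟨n + 1, x⟩, ⟨n, P.d k i x⟩})
    (hedge : ∀ y : P.cube 1, P.d k 0 y = P.corner (!k) (P.d k i x) → y = P.edge k i x)
    {a b : P.cube 0} (ha : a ≠ P.corner (!k) (P.d k i x)) (h : P.Reach k a b)
    (haQ : a ∈ (P.starCompl (P.d k i x)).carrier 0)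
    (hbQ : b ∈ (P.starCompl (P.d k i x)).carrier 0) :
    (P.starCompl (P.d k i x)).toPrecubicalSet.Reach k ⟨a, haQ⟩ ⟨b, hbQ⟩ := by
  have key := reach_starCompl_aux hx hfree hedge ha h
  by_cases hb : b = P.corner (!k) (P.d k i x)
  · subst hb
    exact (key.2 rfl).tail (step_of_mem (edge_mem_starCompl hx hfree hbQ) (P.d_not_edge k i x)
      (P.d_edge k i x) _ _)
  · exact key.1 hb

/-- Pushing a precubical subset off the star of a free face. -/
theorem exists_sub_starCompl (R : Type v) [CommRing R] (hx : P.Regular x)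
    (hfree : P.star (P.d k i x) ⊆ {⟨n + 1, x⟩, ⟨n, P.d k i x⟩}) (X : P.Sub) :
    ∃ X' : P.Sub, (∀ m, X'.carrier m ⊆ (P.starCompl (P.d k i x)).carrier m) ∧
      Set.range (X.incl.homologyClassMap R) ⊆ Set.range (X'.incl.homologyClassMap R) ∧
      ∀ a ∈ X'.carrier 0, a ∈ X.carrier 0 ∨
        (P.d k i x ∈ X.carrier n ∧ a ∈ (cubeSub x).carrier 0) := by
  by_cases hD : P.d k i x ∈ X.carrier n
  -- `X` may contain the face without containing `x`; adding `x` makes the collapse possible.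
  · let Z := X.union (cubeSub x)
    refine ⟨Z.diffStar (P.d k i x), fun m => Set.inter_subset_right, ?_, ?_⟩
    · refine (Sub.range_mono R (Y := Z) fun m => Set.subset_union_left).trans ?_
      exact Z.range_subset_of_collapse R hx (.inr (self_mem_cubeSub x)) fun m z _ h => hfree h
    · exact fun a ha => ha.1.imp id fun h => ⟨hD, h⟩
  -- A cube of `X` in the star would have `d^k_i x` as an iterated face (or be equal to it), which
  -- would then lie in `X`.
  · refine ⟨X, fun m y hy h => hD ?_, subset_rfl, fun a ha => .inl ha⟩
    obtain ⟨c, hc⟩ := h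
    have := X.sharpFun_mem c hy
    exact Eq.subst (motive := fun z => z ∈ X.carrier n) hc this

theorem regular_of_d_ne {y : P.cube 1} (h : P.d false 0 y ≠ P.d true 0 y) : P.Regular y := by
  intro m a b hab
  cases a with
  | vertex l a =>
    cases a
    cases b with
    | vertex l' b =>
      cases b
      change P.d l 0 y = P.d l' 0 y at hab
      cases l <;> cases l'
      · rfl
      · exact absurd hab h
      · exact absurd hab.symm h
      · rfl
  | edge a =>
    cases a
    cases b with
    | vertex l' b => cases b
    | edge b => cases b; rfl

/-- In a weakly regular set, a cube ending in a vertex `v` in which no edge of the cube begins is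
`v` or the only edge ending in `v`. -/
theorem eq_edge_or_eq_vertex (hP : P.WeaklyRegular) {v : P.cube 0} {e : P.cube 1}
    (hedge : ∀ y : P.cube 1, P.d k 0 y = v → y = e) {m : ℕ} (z : P.cube m)
    (hz : (⟨m, z⟩ : Σ n, P.cube n) ∈ P.star v)
    (hno : ∀ y ∈ (cubeSub z).carrier 1, P.d (!k) 0 y ≠ v) :
    (⟨m, z⟩ : Σ n, P.cube n) = ⟨1, e⟩ ∨ (⟨m, z⟩ : Σ n, P.cube n) = ⟨0, v⟩ := by
  obtain ⟨c, hc⟩ := hz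
  dsimp only at c hc
  have key : ∀ (c' : Cell m 1), P.d k 0 (sharpFun c' P z) = sharpFun (Cell.d k 0 c') P z :=
    fun c' => (sharpFun_d k 0 c' P z).symm
  rcases Cell.eq_const_or k c with rfl | ⟨c', rfl⟩
  · match m, z with
    | 0, z => exact .inr (congrArg (Sigma.mk 0) hc)
    | 1, z => exact .inl (congrArg (Sigma.mk 1) (hedge z hc))
    | m + 2, z =>
      have hk : k ≠ !k := by cases k <;> simp
      -- Two different edges of the cube that end in its final corner. Both are sent to `e`, and
      -- neither has an entry `1 - k`, which contradicts weak regularity.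
      let c₁ : Cell (m + 2) 1 := .edge (Cell.const k (m + 1))
      let c₂ : Cell (m + 2) 1 := .vertex k (.edge (Cell.const k m))
      have h₁ : sharpFun c₁ P z = e := hedge _
        ((key c₁).trans (by simp only [c₁, Cell.d_zero_edge]; exact hc))
      have h₂ : sharpFun c₂ P z = e := hedge _
        ((key c₂).trans (by simp only [c₂, Cell.d_vertex, Cell.d_zero_edge]; exact hc))
      have : c₁ = c₂ := hP _ z (!k) 1 c₁ c₂ (Cell.avoids_const hk (m + 1))
        ⟨hk, Cell.avoids_const hk m⟩ (h₁.trans h₂.symm)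
      simp [c₁, c₂] at this
  · refine absurd ?_ (hno _ ⟨c', rfl⟩)
    exact (sharpFun_d (!k) 0 c' P z).symm.trans hc

/-- A precubical subset can be pushed off the corner of the free face if none of its edges begins
there. -/
theorem exists_sub_of_corner_mem (R : Type v) [CommRing R] (hP : P.WeaklyRegular)
    (hx : P.Regular x) (hfree : P.star (P.d k i x) ⊆ {⟨n + 1, x⟩, ⟨n, P.d k i x⟩})
    (hedge : ∀ y : P.cube 1, P.d k 0 y = P.corner (!k) (P.d k i x) → y = P.edge k i x)
    (X : P.Sub) (hX : ∀ m, X.carrier m ⊆ (P.starCompl (P.d k i x)).carrier m)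
    (hv : P.corner (!k) (P.d k i x) ∈ X.carrier 0)
    (hno : ∀ y ∈ X.carrier 1, P.d (!k) 0 y ≠ P.corner (!k) (P.d k i x)) :
    ∃ X' : P.Sub, (∀ m, X'.carrier m ⊆ (P.starCompl (P.d k i x)).carrier m) ∧
      Set.range (X.incl.homologyClassMap R) ⊆ Set.range (X'.incl.homologyClassMap R) ∧
      ∀ a ∈ X'.carrier 0, a ≠ P.corner (!k) (P.d k i x) ∧
        (a ∈ X.carrier 0 ∨ a = P.corner (!k) x) := by
  have h₁ := P.d_edge k i x
  have h₀ := P.d_not_edge k i x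
  have hne := hx.corner_ne k i
  have he := edge_mem_starCompl hx hfree (hX 0 hv)
  have hereg : P.Regular (P.edge k i x) := by
    apply regular_of_d_ne
    cases k
    · exact fun h => hne (h₁.symm.trans (h.trans h₀))
    · exact fun h => hne (h₁.symm.trans (h.symm.trans h₀))
  -- Adding `e` creates no edge beginning in `v`, as `e` begins in `w ≠ v`. So `v` is free in `Z`
  -- and `e` can be collapsed onto `w`.
  let Z := X.union (cubeSub (P.edge k i x))
  have hZno : ∀ y ∈ Z.carrier 1, P.d (!k) 0 y ≠ P.corner (!k) (P.d k i x) := by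
    rintro y (hy | ⟨c, rfl⟩)
    · exact hno y hy
    · cases c with
      | vertex l c => cases c
      | edge c =>
        cases c
        change P.d (!k) 0 (P.edge k i x) ≠ _
        rw [h₀]
        exact hne.symm
  have hfree' : ∀ (m : ℕ) (z : P.cube m), z ∈ Z.carrier m →
      ⟨m, z⟩ ∈ P.star (P.d k 0 (P.edge k i x)) →
      (⟨m, z⟩ : Σ n, P.cube n) = ⟨1, P.edge k i x⟩ ∨
        (⟨m, z⟩ : Σ n, P.cube n) = ⟨0, P.d k 0 (P.edge k i x)⟩ := by
    rw [h₁]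
    intro m z hz hstar
    refine eq_edge_or_eq_vertex hP hedge z hstar ?_
    rintro _ ⟨c, rfl⟩
    exact hZno _ (Z.sharpFun_mem c hz)
  refine ⟨Z.diffStar (P.d k 0 (P.edge k i x)), ?_, ?_, ?_⟩
  · rintro m y ⟨hy | ⟨c, rfl⟩, -⟩
    · exact hX m hy
    · exact (P.starCompl (P.d k i x)).sharpFun_mem c he
  · exact (Sub.range_mono R (Y := Z) fun m => Set.subset_union_left).trans
      (Z.range_subset_of_collapse R hereg (.inr (self_mem_cubeSub _)) hfree')
  · rintro a ⟨ha, ha'⟩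
    have hav : a ≠ P.corner (!k) (P.d k i x) := by
      rintro rfl
      rw [h₁] at ha'
      exact ha' (P.self_mem_star _)
    refine ⟨hav, ha.imp id ?_⟩
    rintro ⟨c, rfl⟩
    cases c with
    | vertex l c =>
      cases c
      by_cases hl : l = k
      · subst hl
        exact absurd h₁ hav
      · obtain rfl : l = !k := Bool.eq_not_of_ne hl
        exact h₀

/-- The hard direction for `↗`. After both subsets are pushed off the star, only paths that start in
`v` remain to be dealt with. -/
theorem exists_subs_reach (R : Type v) [CommRing R] (hP : P.WeaklyRegular)
    (hx : P.Regular x) (hfree : P.star (P.d k i x) ⊆ {⟨n + 1, x⟩, ⟨n, P.d k i x⟩})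
    (hedge : ∀ y : P.cube 1, P.d k 0 y = P.corner (!k) (P.d k i x) → y = P.edge k i x)
    (X Y : P.Sub) (hXY : ∀ a ∈ X.carrier 0, ∀ b ∈ Y.carrier 0, P.Reach k a b) :
    ∃ X' Y' : P.Sub, (∀ m, X'.carrier m ⊆ (P.starCompl (P.d k i x)).carrier m) ∧
      (∀ m, Y'.carrier m ⊆ (P.starCompl (P.d k i x)).carrier m) ∧
      Set.range (X.incl.homologyClassMap R) ⊆ Set.range (X'.incl.homologyClassMap R) ∧
      Set.range (Y.incl.homologyClassMap R) ⊆ Set.range (Y'.incl.homologyClassMap R) ∧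
      ∀ a ∈ X'.carrier 0, ∀ b ∈ Y'.carrier 0,
        ∀ (ha : a ∈ (P.starCompl (P.d k i x)).carrier 0)
          (hb : b ∈ (P.starCompl (P.d k i x)).carrier 0),
          (P.starCompl (P.d k i x)).toPrecubicalSet.Reach k ⟨a, ha⟩ ⟨b, hb⟩ := by
  obtain ⟨Y₁, hY₁, hYr, hYv⟩ := exists_sub_starCompl R hx hfree Y
  obtain ⟨X₁, hX₁, hXr, hXv⟩ := exists_sub_starCompl R hx hfree X
  have hne := hx.corner_ne k i
  have hQ : ∀ a, a ≠ P.corner (!k) (P.d k i x) → (∀ b ∈ Y.carrier 0, P.Reach k a b) →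
      ∀ b ∈ Y₁.carrier 0, ∀ (ha : a ∈ (P.starCompl (P.d k i x)).carrier 0)
        (hb : b ∈ (P.starCompl (P.d k i x)).carrier 0),
        (P.starCompl (P.d k i x)).toPrecubicalSet.Reach k ⟨a, ha⟩ ⟨b, hb⟩ := by
    intro a ha h b hb haQ hbQ
    refine reach_starCompl hx hfree hedge ha ?_ haQ hbQ
    rcases hYv b hb with hb | ⟨hD, c, rfl⟩
    · exact h b hb
    -- `Y` contains `v`, and the path from `a` to `v` passes through `w`, from which every vertex of
    -- `x` can be reached.
    · have := (reach_starCompl_aux hx hfree hedge ha (h _ (Y.corner_mem (!k) hD))).2 rfl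
      exact ((P.starCompl (P.d k i x)).incl.reach this).trans (reach_of_corner k c P x)
  have hX : ∀ a ∈ X₁.carrier 0, ∀ b ∈ Y.carrier 0, P.Reach k a b := by
    intro a ha b hb
    rcases hXv a ha with ha | ⟨hD, c, rfl⟩
    · exact hXY a ha b hb
    · refine (reach_corner k c P x).trans ?_
      rw [← P.corner_d k i x]
      exact hXY _ (X.corner_mem k hD) b hb
  have hw : P.corner (!k) (P.d k i x) ∈ X₁.carrier 0 →
      ∀ b ∈ Y.carrier 0, P.Reach k (P.corner (!k) x) b := by
    intro hv b hb
    have hv' : P.corner (!k) (P.d k i x) ∈ X.carrier 0 := by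
      rcases hXv _ hv with h | ⟨hD, -⟩
      · exact h
      · exact X.corner_mem (!k) hD
    exact (hXY _ hv' b hb).head ⟨P.edge k i x, P.d_not_edge k i x, P.d_edge k i x⟩
  by_cases hv : P.corner (!k) (P.d k i x) ∈ X₁.carrier 0
  · by_cases hno : ∀ y ∈ X₁.carrier 1, P.d (!k) 0 y ≠ P.corner (!k) (P.d k i x)
    · obtain ⟨X₂, hX₂, hXr₂, hXv₂⟩ :=
        exists_sub_of_corner_mem R hP hx hfree hedge X₁ hX₁ hv hno
      refine ⟨X₂, Y₁, hX₂, hY₁, hXr.trans hXr₂, hYr, fun a ha => hQ a (hXv₂ a ha).1 ?_⟩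
      rcases (hXv₂ a ha).2 with h | rfl
      · exact hX a h
      · exact hw hv
    · push Not at hno
      obtain ⟨y, hy, hy₀⟩ := hno
      refine ⟨X₁, Y₁, hX₁, hY₁, hXr, hYr, fun a ha b hb haQ hbQ => ?_⟩
      by_cases hav : a = P.corner (!k) (P.d k i x)
      -- The edge `y` leads from `v` to another vertex of `X₁`, because the only edge that ends in
      -- `v` begins in `w`. From there the case of a start outside `v` applies.
      · have hr : P.d k 0 y ≠ P.corner (!k) (P.d k i x) := by
          intro h
          rw [hedge y h, d_not_edge] at hy₀
          exact hne hy₀.symm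
        have hrX := X₁.d_mem k 0 y hy
        exact (hQ _ hr (hX _ hrX) b hb (hX₁ 0 hrX) hbQ).head
          (step_of_mem (hX₁ 1 hy) (hy₀.trans hav.symm) rfl _ _)
      · exact hQ a hav (hX a ha) b hb haQ hbQ
  · refine ⟨X₁, Y₁, hX₁, hY₁, hXr, hYr, fun a ha => ?_⟩
    have hav : a ≠ P.corner (!k) (P.d k i x) := by
      rintro rfl
      exact hv ha
    exact hQ a hav (hX a ha)

/-! ### Transfer of the relation `↗` between a precubical set and a precubical subset -/

/-- The relation `↗` for `k = 1` and its converse for `k = 0`. -/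
theorem exists_reach_iff_pointsTo (R : Type v) [CommRing R] (k : Bool)
    (α β : P.HomologyClass R) :
    (∃ X Y : P.Sub, α ∈ Set.range (X.incl.homologyClassMap R) ∧
      β ∈ Set.range (Y.incl.homologyClassMap R) ∧
      ∀ a ∈ X.carrier 0, ∀ b ∈ Y.carrier 0, P.Reach k a b) ↔
    if k then P.PointsTo R α β else P.PointsTo R β α := by
  cases k
  · simp only [PointsTo, accessible_iff_reach, reach_false_iff, Bool.false_eq_true, if_false]
    exact ⟨fun ⟨X, Y, hα, hβ, h⟩ => ⟨Y, X, hβ, hα, fun b hb a ha => h a ha b hb⟩,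
      fun ⟨Y, X, hβ, hα, h⟩ => ⟨X, Y, hα, hβ, fun a ha b hb => h b hb a ha⟩⟩
  · simp only [PointsTo, accessible_iff_reach, if_true]

/-- The image of a precubical subset of a precubical subset. -/
def Sub.image {Q : P.Sub} (X : Q.toPrecubicalSet.Sub) : P.Sub where
  carrier m := {y | ∃ h : y ∈ Q.carrier m, (⟨y, h⟩ : Q.toPrecubicalSet.cube m) ∈ X.carrier m}
  d_mem k _ i y := fun ⟨h, h'⟩ => ⟨Q.d_mem k i y h, X.d_mem k i _ h'⟩

/-- A precubical subset contained in another one, as a precubical subset of the latter. -/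
def Sub.restrict (Q X : P.Sub) : Q.toPrecubicalSet.Sub where
  carrier m := {y | y.1 ∈ X.carrier m}
  d_mem k _ i y h := X.d_mem k i y.1 h

theorem Sub.homologyClassMap_mem_range_image (R : Type v) [CommRing R] {Q : P.Sub}
    (X : Q.toPrecubicalSet.Sub) {α : Q.toPrecubicalSet.HomologyClass R}
    (h : α ∈ Set.range (X.incl.homologyClassMap R)) :
    Q.incl.homologyClassMap R α ∈ Set.range ((Sub.image X).incl.homologyClassMap R) := by
  obtain ⟨γ, rfl⟩ := h
  let f : Hom X.toPrecubicalSet (Sub.image X).toPrecubicalSet :=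
    { app := fun y => ⟨y.1.1, y.1.2, y.2⟩
      app_d := fun _ _ _ _ => rfl }
  refine ⟨f.homologyClassMap R γ, ?_⟩
  rw [← Hom.homologyClassMap_comp, ← Hom.homologyClassMap_comp]
  rfl

/-- A class coming from `X` is known only in `P`; injectivity of the map induced by the inclusion of
`Q` identifies it with `α` in `Q` itself. -/
theorem Sub.mem_range_restrict (R : Type v) [CommRing R] {Q X : P.Sub}
    (hX : ∀ m, X.carrier m ⊆ Q.carrier m)
    (hQ : Function.Injective (Q.incl.homologyClassMap R)) {α : Q.toPrecubicalSet.HomologyClass R}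
    (h : Q.incl.homologyClassMap R α ∈ Set.range (X.incl.homologyClassMap R)) :
    α ∈ Set.range ((Q.restrict X).incl.homologyClassMap R) := by
  obtain ⟨γ, hγ⟩ := h
  let f : Hom X.toPrecubicalSet (Q.restrict X).toPrecubicalSet :=
    { app := fun y => ⟨⟨y.1, hX _ y.2⟩, y.2⟩
      app_d := fun _ _ _ _ => rfl }
  refine ⟨f.homologyClassMap R γ, hQ ?_⟩
  rw [← hγ, ← Hom.homologyClassMap_comp, ← Hom.homologyClassMap_comp]
  rfl

theorem pointsTo_starCompl_iff (R : Type v) [CommRing R] (hP : P.WeaklyRegular)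
    (hx : P.Regular x) (hfree : P.star (P.d k i x) ⊆ {⟨n + 1, x⟩, ⟨n, P.d k i x⟩})
    (hedge : ∀ y : P.cube 1, P.d k 0 y = P.corner (!k) (P.d k i x) → y = P.edge k i x)
    (α β : (P.starCompl (P.d k i x)).toPrecubicalSet.HomologyClass R) :
    (∃ X Y : (P.starCompl (P.d k i x)).toPrecubicalSet.Sub,
      α ∈ Set.range (X.incl.homologyClassMap R) ∧ β ∈ Set.range (Y.incl.homologyClassMap R) ∧
      ∀ a ∈ X.carrier 0, ∀ b ∈ Y.carrier 0,
        (P.starCompl (P.d k i x)).toPrecubicalSet.Reach k a b) ↔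
    ∃ X Y : P.Sub,
      (P.starCompl (P.d k i x)).incl.homologyClassMap R α ∈
        Set.range (X.incl.homologyClassMap R) ∧
      (P.starCompl (P.d k i x)).incl.homologyClassMap R β ∈
        Set.range (Y.incl.homologyClassMap R) ∧
      ∀ a ∈ X.carrier 0, ∀ b ∈ Y.carrier 0, P.Reach k a b := by
  constructor
  · rintro ⟨X, Y, hα, hβ, h⟩
    refine ⟨Sub.image X, Sub.image Y, Sub.homologyClassMap_mem_range_image R X hα,
      Sub.homologyClassMap_mem_range_image R Y hβ, ?_⟩
    rintro a ⟨haQ, ha⟩ b ⟨hbQ, hb⟩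
    exact (P.starCompl (P.d k i x)).incl.reach (h _ ha _ hb)
  · rintro ⟨X, Y, hα, hβ, h⟩
    obtain ⟨X', Y', hX', hY', hXr, hYr, h'⟩ := exists_subs_reach R hP hx hfree hedge X Y h
    have hinj := (homologyClassMap_incl_starCompl_bijective R hx hfree).1
    exact ⟨Sub.restrict _ X', Sub.restrict _ Y', Sub.mem_range_restrict R hX' hinj (hXr hα),
      Sub.mem_range_restrict R hY' hinj (hYr hβ),
      fun a ha b hb => h' a.1 ha b.1 hb a.2 b.2⟩

end PrecubicalSet

theorem theorem4 (R : Type v) [CommRing R] (P : PrecubicalSet.{u}) (hP : P.WeaklyRegular)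
    (n : ℕ) (x : P.cube (n + 1)) (hx : P.Regular x) (k : Bool) (i : Fin (n + 1))
    (hfree : P.IsFreeFace k i x)
    (hedge : ¬ ∃ y : P.cube 1, y ≠ P.edge k i x ∧ P.d k 0 y = P.corner (!k) (P.d k i x)) :
    (P.starCompl (P.d k i x)).incl.IsHomologyGraphIso R := by
  have hedge' : ∀ y : P.cube 1, P.d k 0 y = P.corner (!k) (P.d k i x) → y = P.edge k i x :=
    fun y hy => by_contra fun h => hedge ⟨y, h, hy⟩
  refine ⟨PrecubicalSet.homologyClassMap_incl_starCompl_bijective R hx hfree.subset, ?_⟩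
  intro α β
  -- For `k = 0` the direction of paths is reversed, so the roles of `α` and `β` are exchanged.
  cases k
  · have h := PrecubicalSet.pointsTo_starCompl_iff R hP hx hfree.subset hedge' β α
    rwa [PrecubicalSet.exists_reach_iff_pointsTo, PrecubicalSet.exists_reach_iff_pointsTo] at h
  · have h := PrecubicalSet.pointsTo_starCompl_iff R hP hx hfree.subset hedge' α β
    rwa [PrecubicalSet.exists_reach_iff_pointsTo, PrecubicalSet.exists_reach_iff_pointsTo] at h
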